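/- Let $\alpha\in(1,2)$ and let $X$ be a symmetric $\alpha$-stable real random variable with Lévy measure $|x|^{-\alpha-1}\,dx$, i.e. with characteristic function $$\mathbb{E}\,e^{itX}=\exp\left(\int_{-\infty}^{+\infty}\bigl(e^{itx}-1-itx\bigr)\frac{dx}{|x|^{\alpha+1}}\right),\qquad t\in\mathbb{R}.$$ For every $y\in\left[\frac{2}{\sqrt{2-\alpha}},\frac{2}{2-\alpha}\right]$ one has $$\mathbb{P}(X\ge 2y)\le\frac{10}{3}\,\frac{1}{y^{\alpha}}+e^{\frac{2}{45}}e^{-\frac14(2-\alpha)y^2}$$ and $$\mathbb{P}\left(X\ge\frac{\sqrt2}{4}\,y\right)\ge\frac{1}{6e^{5}}\,\frac{1}{y^{\alpha}}+\frac{1}{6e}\,e^{-(2-\alpha)y^2},$$ while for every $y\ge\frac{2}{2-\alpha}$ one has $$\mathbb{P}(X\ge 2y)\le\frac{16}{3}\,\frac{1}{y^{\alpha}}\qquad\text{and}\qquad \mathbb{P}(X\ge y)\ge\frac12\,\frac{1}{2+\alpha y^{\alpha}}.$$ -/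

import Mathlib

open MeasureTheory

/-- The symmetric `α`-stable Lévy measure `ν(dx) = |x|^{-α-1} dx` on `ℝ`. -/
noncomputable def symmetricStableLevyMeasure (α : ℝ) : Measure ℝ :=
  volume.withDensity fun x : ℝ => ENNReal.ofReal (|x| ^ (-α - 1))

/-- For `α ∈ (1, 2)`: `X` is, under `P`, a symmetric `α`-stable random variable with
Lévy measure `|x|^{-α-1} dx`, i.e. its characteristic function is
`E exp(itX) = exp (∫ (e^{itx} - 1 - itx) |x|^{-α-1} dx)`. The compensator `itx` makes the
integral absolutely convergent for `α ∈ (1, 2)`; it drops out by symmetry if the integral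
is read as a principal value. -/
structure IsSymmetricStable {Ω : Type*} [MeasurableSpace Ω] (P : Measure Ω) (α : ℝ)
    (X : Ω → ℝ) : Prop where
  aemeasurable : AEMeasurable X P
  charFun_eq : ∀ t : ℝ, charFun (P.map X) t =
    Complex.exp (∫ x : ℝ, (Complex.exp (t * x * Complex.I) - 1 - t * x * Complex.I)
      ∂(symmetricStableLevyMeasure α))

open Filter Topology Set
open scoped ENNReal Nat

/-!
The law of `X` is the weak limit of the compound Poisson laws that keep only the jumps of size
more than `1 / n`, so it suffices to estimate the tails of symmetric compound Poisson laws,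
uniformly in the truncation.

*Polynomial lower bound.* Given that some jump exceeds `y` in absolute value, the first such jump
is equally likely to be positive or negative, and the symmetric sum of the remaining jumps has
probability at least `1 / 2` of not working against it. Hence
`P(X ≥ y) ≥ (1 - exp (-2 ν (y, ∞))) / 4`.

*Upper bound.* Off an event of probability at most `1 / y ^ α` there is no jump larger than `y`, and
Chernoff's bound applies to the remaining jumps with exponent `u / y`. The right `u` is the smaller
of `log (y ^ α)`, which gives the polynomial tail, and `(2 - α) y ^ 2 / 4`, which gives the
Gaussian one. Beyond `2 / (2 - α)` the logarithm always wins.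

*Gaussian lower bound.* The Paley–Zygmund inequality is applied to `exp (s Z)`, where `Z` is the
sum of the jumps of size at most `1`, with `s = (2 - α) y / 2`. The jumps larger than `1` have a
symmetric sum, so they cost only a factor `1 / 2`.
-/

/-! ### Compound Poisson laws -/

section CompoundPoisson

variable {M : Type*} [AddMonoid M] [MeasurableSpace M]

/-- The `k`-fold convolution power of a measure: the law of the sum of `k` independent
variables with law `ν`, when `ν` is a probability measure. -/
noncomputable def convPow (ν : Measure M) : ℕ → Measure M
  | 0 => Measure.dirac 0
  | k + 1 => ν ∗ convPow ν k

/-- The compound Poisson law with finite Lévy measure `ν`: the law of the sum of a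
`Poisson (ν univ)` number of independent jumps with law `ν / ν univ`. -/
noncomputable def compoundPoisson (ν : Measure M) : Measure M :=
  Measure.sum fun k : ℕ => ENNReal.ofReal (Real.exp (-ν.real univ) / k !) • convPow ν k

/-- The measure `κ` in the decomposition `compoundPoisson ν = exp (-ν univ) • δ₀ + ν ∗ κ` of a
compound Poisson law according to its first jump. -/
noncomputable def compoundPoissonRest (ν : Measure M) : Measure M :=
  Measure.sum fun k : ℕ => ENNReal.ofReal (Real.exp (-ν.real univ) / (k + 1)!) • convPow ν k

theorem compoundPoissonRest_le_compoundPoisson (ν : Measure M) :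
    compoundPoissonRest ν ≤ compoundPoisson ν := by
  refine Measure.le_iff.2 fun s hs => ?_
  rw [compoundPoissonRest, compoundPoisson, Measure.sum_apply _ hs, Measure.sum_apply _ hs]
  refine ENNReal.tsum_le_tsum fun k => ?_
  simp only [Measure.smul_apply, smul_eq_mul]
  gcongr
  exact k.le_succ

variable [MeasurableAdd₂ M]

instance isFiniteMeasure_convPow (ν : Measure M) [IsFiniteMeasure ν] (k : ℕ) :
    IsFiniteMeasure (convPow ν k) := by
  induction k with
  | zero => unfold convPow; infer_instance
  | succ k ih => unfold convPow; infer_instance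

theorem conv_apply (μ ν : Measure M) [SFinite ν] {s : Set M} (hs : MeasurableSet s) :
    (μ ∗ ν) s = ∫⁻ x, ν ((fun y => x + y) ⁻¹' s) ∂μ := by
  rw [Measure.conv, Measure.map_apply measurable_add hs, Measure.prod_apply (measurable_add hs)]
  rfl

theorem lintegral_conv_of_map_add {f : M → ℝ≥0∞} (hf : Measurable f)
    (hadd : ∀ x y, f (x + y) = f x * f y) (μ ν : Measure M) [SFinite ν] :
    ∫⁻ x, f x ∂(μ ∗ ν) = (∫⁻ x, f x ∂μ) * ∫⁻ x, f x ∂ν := by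
  rw [Measure.lintegral_conv hf, ← lintegral_mul_const _ hf]
  simp_rw [hadd, lintegral_const_mul _ hf]

theorem conv_apply_univ (μ ν : Measure M) [SFinite ν] : (μ ∗ ν) univ = μ univ * ν univ := by
  simpa using lintegral_conv_of_map_add (f := fun _ => 1) measurable_const (by simp) μ ν

theorem lintegral_convPow_of_map_add {f : M → ℝ≥0∞} (hf : Measurable f) (hzero : f 0 = 1)
    (hadd : ∀ x y, f (x + y) = f x * f y) (ν : Measure M) [IsFiniteMeasure ν] (k : ℕ) :
    ∫⁻ x, f x ∂(convPow ν k) = (∫⁻ x, f x ∂ν) ^ k := by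
  induction k with
  | zero => simp [convPow, lintegral_dirac' _ hf, hzero]
  | succ k ih => rw [convPow, lintegral_conv_of_map_add hf hadd, ih, pow_succ']

theorem ofReal_exp_neg_mul_tsum (m I : ℝ) (hI : 0 ≤ I) :
    ∑' k : ℕ, ENNReal.ofReal (Real.exp (-m) / k !) * ENNReal.ofReal I ^ k =
      ENNReal.ofReal (Real.exp (I - m)) := by
  have hexp : HasSum (fun k : ℕ => Real.exp (-m) / k ! * I ^ k) (Real.exp (I - m)) := by
    have h := (NormedSpace.expSeries_div_hasSum_exp I).mul_left (Real.exp (-m))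
    rw [← Real.exp_eq_exp_ℝ, ← Real.exp_add, neg_add_eq_sub] at h
    exact h.congr_fun fun k => by ring
  rw [← hexp.tsum_eq, ENNReal.ofReal_tsum_of_nonneg (fun k => by positivity) hexp.summable]
  exact tsum_congr fun k => by rw [ENNReal.ofReal_mul (by positivity), ENNReal.ofReal_pow hI]

theorem lintegral_compoundPoisson_of_map_add {f : M → ℝ≥0∞} (hf : Measurable f) (hzero : f 0 = 1)
    (hadd : ∀ x y, f (x + y) = f x * f y) {ν : Measure M} [IsFiniteMeasure ν]
    (hfin : ∫⁻ x, f x ∂ν ≠ ∞) :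
    ∫⁻ x, f x ∂(compoundPoisson ν) =
      ENNReal.ofReal (Real.exp ((∫⁻ x, f x ∂ν).toReal - ν.real univ)) := by
  rw [compoundPoisson, lintegral_sum_measure, ← ofReal_exp_neg_mul_tsum _ _ ENNReal.toReal_nonneg,
    ENNReal.ofReal_toReal hfin]
  simp_rw [lintegral_smul_measure, lintegral_convPow_of_map_add hf hzero hadd, smul_eq_mul]

instance isProbabilityMeasure_compoundPoisson (ν : Measure M) [IsFiniteMeasure ν] :
    IsProbabilityMeasure (compoundPoisson ν) := by
  have h := lintegral_compoundPoisson_of_map_add (ν := ν) (f := fun _ => 1) measurable_const rfl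
    (by simp) (by simp)
  exact ⟨by simpa [measureReal_def] using h⟩

instance isFiniteMeasure_compoundPoissonRest (ν : Measure M) [IsFiniteMeasure ν] :
    IsFiniteMeasure (compoundPoissonRest ν) :=
  isFiniteMeasure_of_le _ (compoundPoissonRest_le_compoundPoisson ν)

theorem compoundPoisson_eq_add_conv_rest (ν : Measure M) [IsFiniteMeasure ν] :
    compoundPoisson ν = ENNReal.ofReal (Real.exp (-ν.real univ)) • Measure.dirac 0 +
      ν ∗ compoundPoissonRest ν := by
  have hconv : ν ∗ compoundPoissonRest ν = Measure.sum fun k : ℕ =>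
      ENNReal.ofReal (Real.exp (-ν.real univ) / (k + 1)!) • convPow ν (k + 1) := by
    rw [compoundPoissonRest, Measure.conv, Measure.prod_sum_right, Measure.map_sum (by fun_prop)]
    simp only [Measure.prod_smul_right, Measure.map_smul, convPow, Measure.conv]
  ext s hs
  rw [compoundPoisson, hconv, Measure.add_apply, Measure.sum_apply _ hs, Measure.sum_apply _ hs,
    tsum_eq_zero_add' ENNReal.summable]
  simp [convPow]

theorem compoundPoisson_conv_eq_add (ν μ : Measure M) [IsFiniteMeasure ν] [IsFiniteMeasure μ] :
    compoundPoisson ν ∗ μ = ENNReal.ofReal (Real.exp (-ν.real univ)) • μ +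
      ν ∗ (compoundPoissonRest ν ∗ μ) := by
  rw [compoundPoisson_eq_add_conv_rest, Measure.add_conv, Measure.conv_smul_left,
    Measure.dirac_zero_conv, Measure.conv_assoc]

theorem measure_univ_mul_compoundPoissonRest_univ (ν : Measure M) [IsFiniteMeasure ν] :
    ν univ * compoundPoissonRest ν univ = ENNReal.ofReal (1 - Real.exp (-ν.real univ)) := by
  have h : ENNReal.ofReal (Real.exp (-ν.real univ)) + ν univ * compoundPoissonRest ν univ = 1 := by
    rw [← measure_univ (μ := compoundPoisson ν), compoundPoisson_eq_add_conv_rest,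
      Measure.add_apply, conv_apply_univ]
    simp
  rw [ENNReal.ofReal_sub _ (Real.exp_pos _).le, ENNReal.ofReal_one, ← h,
    ENNReal.add_sub_cancel_left ENNReal.ofReal_ne_top]

theorem compoundPoisson_conv_real_le (ν μ : Measure M) [IsFiniteMeasure ν] [IsProbabilityMeasure μ]
    (s : Set M) : (compoundPoisson ν ∗ μ).real s ≤ ν.real univ + μ.real s := by
  have hrest : (ν ∗ (compoundPoissonRest ν ∗ μ)) s ≤ ENNReal.ofReal (ν.real univ) := by
    refine (measure_mono s.subset_univ).trans ?_
    rw [conv_apply_univ, conv_apply_univ, measure_univ (μ := μ), mul_one,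
      measure_univ_mul_compoundPoissonRest_univ]
    gcongr
    linarith [Real.add_one_le_exp (-ν.real univ)]
  have hzero : ENNReal.ofReal (Real.exp (-ν.real univ)) * μ s ≤ μ s :=
    mul_le_of_le_one_left' (by simp)
  have h : (compoundPoisson ν ∗ μ) s ≤ ENNReal.ofReal (ν.real univ) + μ s := by
    rw [compoundPoisson_conv_eq_add, Measure.add_apply, Measure.smul_apply, smul_eq_mul, add_comm]
    gcongr
  have h' := ENNReal.toReal_mono (by finiteness) h
  rwa [ENNReal.toReal_add (by finiteness) (by finiteness),
    ENNReal.toReal_ofReal measureReal_nonneg] at h'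

end CompoundPoisson

section InnerProductSpace

variable {E : Type*} [NormedAddCommGroup E] [InnerProductSpace ℝ E] [MeasurableSpace E]
  [BorelSpace E] [SecondCountableTopology E]

theorem charFun_convPow (ν : Measure E) [IsFiniteMeasure ν] (k : ℕ) (t : E) :
    charFun (convPow ν k) t = charFun ν t ^ k := by
  induction k with
  | zero => simp [convPow]
  | succ k ih => rw [convPow, charFun_conv, ih, pow_succ']

theorem integrable_exp_inner_mul_I (μ : Measure E) [IsFiniteMeasure μ] (t : E) :
    Integrable (fun x => Complex.exp (inner ℝ x t * Complex.I)) μ :=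
  Integrable.of_bound (by fun_prop) 1 (ae_of_all _ fun x => (Complex.norm_exp_ofReal_mul_I _).le)

theorem charFun_compoundPoisson (ν : Measure E) [IsFiniteMeasure ν] (t : E) :
    charFun (compoundPoisson ν) t = Complex.exp (charFun ν t - ν.real univ) := by
  have hterm (k : ℕ) : ∫ x, Complex.exp (inner ℝ x t * Complex.I)
      ∂(ENNReal.ofReal (Real.exp (-ν.real univ) / k !) • convPow ν k) =
      Complex.exp (-ν.real univ) * (charFun ν t ^ k / k !) := by
    rw [integral_smul_measure, ← charFun_apply, charFun_convPow,
      ENNReal.toReal_ofReal (by positivity), Complex.real_smul]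
    push_cast
    ring
  have hexp := (NormedSpace.expSeries_div_hasSum_exp (charFun ν t)).mul_left
    (Complex.exp (-ν.real univ))
  rw [← Complex.exp_eq_exp_ℂ, ← Complex.exp_add, neg_add_eq_sub] at hexp
  rw [charFun_apply, ← hexp.tsum_eq, compoundPoisson,
    ← (hasSum_integral_measure (integrable_exp_inner_mul_I (compoundPoisson ν) t)).tsum_eq]
  exact tsum_congr hterm

theorem compoundPoisson_add [CompleteSpace E] (ν₁ ν₂ : Measure E) [IsFiniteMeasure ν₁]
    [IsFiniteMeasure ν₂] :
    compoundPoisson (ν₁ + ν₂) = compoundPoisson ν₁ ∗ compoundPoisson ν₂ := by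
  refine Measure.ext_of_charFun (funext fun t => ?_)
  have hadd : charFun (ν₁ + ν₂) t = charFun ν₁ t + charFun ν₂ t :=
    integral_add_measure (integrable_exp_inner_mul_I ν₁ t) (integrable_exp_inner_mul_I ν₂ t)
  rw [charFun_conv, charFun_compoundPoisson, charFun_compoundPoisson, charFun_compoundPoisson,
    ← Complex.exp_add, hadd, measureReal_add_apply]
  congr 1
  push_cast
  ring

theorem compoundPoisson_eq_conv_restrict [CompleteSpace E] (ν : Measure E) [IsFiniteMeasure ν]
    {s : Set E} (hs : MeasurableSet s) :
    compoundPoisson ν = compoundPoisson (ν.restrict s) ∗ compoundPoisson (ν.restrict sᶜ) := by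
  rw [← compoundPoisson_add, Measure.restrict_add_restrict_compl hs]

end InnerProductSpace

/-! ### Symmetric measures -/

section Symmetric

section AddCommGroup

variable {M : Type*} [AddCommGroup M] [MeasurableSpace M]

theorem isNegInvariant_iff_map_neg {μ : Measure M} :
    μ.IsNegInvariant ↔ μ.map Neg.neg = μ :=
  ⟨fun h => h.neg_eq_self, fun h => ⟨h⟩⟩

variable [MeasurableNeg M]

theorem isNegInvariant_restrict (μ : Measure M) [μ.IsNegInvariant] {s : Set M}
    (hs : Neg.neg ⁻¹' s = s) : (μ.restrict s).IsNegInvariant := by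
  have h := ((Measure.measurePreserving_neg μ).restrict_preimage_emb
    (MeasurableEquiv.neg M).measurableEmbedding s).map_eq
  rwa [hs, ← isNegInvariant_iff_map_neg] at h

theorem isNegInvariant_sum_smul {ι : Type*} (c : ι → ℝ≥0∞) (m : ι → Measure M)
    [∀ i, (m i).IsNegInvariant] : (Measure.sum fun i => c i • m i).IsNegInvariant := by
  rw [isNegInvariant_iff_map_neg, Measure.map_sum (by fun_prop)]
  congr! 2 with i
  rw [Measure.map_smul, isNegInvariant_iff_map_neg.1 inferInstance]

theorem integral_eq_integral_half_add_neg {𝕜 : Type*} [RCLike 𝕜] {μ : Measure M}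
    [μ.IsNegInvariant] {f : M → 𝕜} (hf : Integrable f μ) :
    ∫ x, f x ∂μ = ∫ x, (f x + f (-x)) / 2 ∂μ := by
  rw [integral_div, integral_add hf hf.comp_neg, integral_neg_eq_self, ← two_mul,
    mul_div_cancel_left₀ _ two_ne_zero]

variable [MeasurableAdd₂ M]

instance isNegInvariant_conv (μ ν : Measure M) [SFinite μ] [SFinite ν] [μ.IsNegInvariant]
    [ν.IsNegInvariant] : (μ ∗ ν).IsNegInvariant := by
  have h := Measure.map_conv_addMonoidHom (μ := μ) (ν := ν) (negAddMonoidHom (α := M))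
    measurable_neg
  rw [isNegInvariant_iff_map_neg]
  exact h.trans (congrArg₂ _ (isNegInvariant_iff_map_neg.1 ‹_›) (isNegInvariant_iff_map_neg.1 ‹_›))

instance isNegInvariant_convPow (ν : Measure M) [IsFiniteMeasure ν] [ν.IsNegInvariant] (k : ℕ) :
    (convPow ν k).IsNegInvariant := by
  induction k with
  | zero => rw [isNegInvariant_iff_map_neg, convPow, Measure.map_dirac' measurable_neg, neg_zero]
  | succ k ih => unfold convPow; infer_instance

instance isNegInvariant_compoundPoisson (ν : Measure M) [IsFiniteMeasure ν] [ν.IsNegInvariant] :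
    (compoundPoisson ν).IsNegInvariant :=
  isNegInvariant_sum_smul _ _

instance isNegInvariant_compoundPoissonRest (ν : Measure M) [IsFiniteMeasure ν]
    [ν.IsNegInvariant] : (compoundPoissonRest ν).IsNegInvariant :=
  isNegInvariant_sum_smul _ _

end AddCommGroup

section NormedSpace

variable {E : Type*} [NormedAddCommGroup E] [MeasurableSpace E] [BorelSpace E]

theorem measurableSet_le_norm (y : ℝ) : MeasurableSet {x : E | y ≤ ‖x‖} :=
  measurableSet_le measurable_const measurable_norm

variable [NormedSpace ℝ E]

theorem measure_univ_le_two_mul_le_norm_add (ρ : Measure E) [ρ.IsNegInvariant] {x : E} {y : ℝ}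
    (hx : y ≤ ‖x‖) : ρ univ ≤ 2 * ρ {w | y ≤ ‖x + w‖} := by
  have hneg : ρ {w | y ≤ ‖x - w‖} = ρ {w | y ≤ ‖x + w‖} := by
    rw [← Measure.measure_preimage_neg ρ {w | y ≤ ‖x - w‖}]
    simp
  have hcover : {w | y ≤ ‖x + w‖} ∪ {w | y ≤ ‖x - w‖} = univ := by
    refine eq_univ_of_forall fun w => ?_
    have htri : 2 * ‖x‖ ≤ ‖x + w‖ + ‖x - w‖ := by
      simpa [← two_smul ℝ x, norm_smul] using norm_add_le (x + w) (x - w)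
    rcases le_total y ‖x + w‖ with h | h
    · exact Or.inl h
    · exact Or.inr (show y ≤ ‖x - w‖ by linarith)
  calc ρ univ ≤ ρ {w | y ≤ ‖x + w‖} + ρ {w | y ≤ ‖x - w‖} := hcover ▸ measure_union_le _ _
    _ = 2 * ρ {w | y ≤ ‖x + w‖} := by rw [hneg, two_mul]

variable [SecondCountableTopology E]

theorem measure_le_norm_mul_le_two_mul_conv (ν ρ : Measure E) [SFinite ρ] [ρ.IsNegInvariant]
    (y : ℝ) : ν {x | y ≤ ‖x‖} * ρ univ ≤ 2 * (ν ∗ ρ) {x | y ≤ ‖x‖} := by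
  have hmeas := measurableSet_le_norm (E := E) y
  calc ν {x | y ≤ ‖x‖} * ρ univ = ∫⁻ _ in {x | y ≤ ‖x‖}, ρ univ ∂ν := by
        rw [setLIntegral_const, mul_comm]
    _ ≤ ∫⁻ x in {x | y ≤ ‖x‖}, 2 * ρ {w | y ≤ ‖x + w‖} ∂ν :=
        setLIntegral_mono' hmeas fun x hx => measure_univ_le_two_mul_le_norm_add ρ hx
    _ ≤ ∫⁻ x, 2 * ρ {w | y ≤ ‖x + w‖} ∂ν := setLIntegral_le_lintegral _ _
    _ = 2 * (ν ∗ ρ) {x | y ≤ ‖x‖} := by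
        rw [lintegral_const_mul' _ _ ENNReal.ofNat_ne_top, conv_apply ν ρ hmeas]
        rfl

/-- The inequality of Lévy type: conditionally on the first big jump, the sum of the remaining
jumps is symmetric, hence pushes the variable outwards with probability at least one half. -/
theorem one_sub_exp_le_two_mul_compoundPoisson_conv (ν μ : Measure E) [IsFiniteMeasure ν]
    [IsProbabilityMeasure μ] [ν.IsNegInvariant] [μ.IsNegInvariant] {y : ℝ}
    (hν : ∀ᵐ x ∂ν, y ≤ ‖x‖) :
    1 - Real.exp (-ν.real univ) ≤ 2 * (compoundPoisson ν ∗ μ).real {x | y ≤ ‖x‖} := by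
  have hjump : ν {x | y ≤ ‖x‖} = ν univ := measure_congr (eventuallyEq_univ.2 hν)
  have h : ENNReal.ofReal (1 - Real.exp (-ν.real univ)) ≤
      2 * (compoundPoisson ν ∗ μ) {x | y ≤ ‖x‖} := by
    calc ENNReal.ofReal (1 - Real.exp (-ν.real univ))
        = ν {x | y ≤ ‖x‖} * (compoundPoissonRest ν ∗ μ) univ := by
          rw [hjump, conv_apply_univ, measure_univ (μ := μ), mul_one,
            measure_univ_mul_compoundPoissonRest_univ]
      _ ≤ 2 * (ν ∗ (compoundPoissonRest ν ∗ μ)) {x | y ≤ ‖x‖} :=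
          measure_le_norm_mul_le_two_mul_conv _ _ y
      _ ≤ 2 * (compoundPoisson ν ∗ μ) {x | y ≤ ‖x‖} := by
          rw [compoundPoisson_conv_eq_add, Measure.add_apply]
          gcongr
          exact le_add_self
  simpa [measureReal_def] using (ENNReal.ofReal_le_iff_le_toReal (by finiteness)).1 h

end NormedSpace

theorem one_sub_exp_le_two_mul_compoundPoisson {E : Type*} [NormedAddCommGroup E]
    [InnerProductSpace ℝ E] [CompleteSpace E] [MeasurableSpace E] [BorelSpace E]
    [SecondCountableTopology E] (ν : Measure E) [IsFiniteMeasure ν] [ν.IsNegInvariant] (y : ℝ) :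
    1 - Real.exp (-ν.real {x | y ≤ ‖x‖}) ≤ 2 * (compoundPoisson ν).real {x | y ≤ ‖x‖} := by
  have hmeas := measurableSet_le_norm (E := E) y
  have : (ν.restrict {x | y ≤ ‖x‖}).IsNegInvariant := isNegInvariant_restrict ν (by ext; simp)
  have : (ν.restrict {x | y ≤ ‖x‖}ᶜ).IsNegInvariant := isNegInvariant_restrict ν (by ext; simp)
  rw [compoundPoisson_eq_conv_restrict ν hmeas, ← measureReal_restrict_apply_univ]
  exact one_sub_exp_le_two_mul_compoundPoisson_conv _ _ (ae_restrict_mem hmeas)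

section Real

theorem real_Iic_neg_eq_real_Ici (μ : Measure ℝ) [μ.IsNegInvariant] (y : ℝ) :
    μ.real (Iic (-y)) = μ.real (Ici y) := by
  rw [measureReal_def, measureReal_def, ← Measure.measure_preimage_neg μ (Ici y)]
  simp

theorem real_le_norm_eq_two_mul_real_Ici (μ : Measure ℝ) [IsFiniteMeasure μ] [μ.IsNegInvariant]
    {y : ℝ} (hy : 0 < y) : μ.real {x | y ≤ ‖x‖} = 2 * μ.real (Ici y) := by
  have hunion : {x : ℝ | y ≤ ‖x‖} = Iic (-y) ∪ Ici y := by
    ext x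
    simp [le_abs']
  have hdisj : Disjoint (Iic (-y)) (Ici y) := Iic_disjoint_Ici.2 (by linarith)
  rw [hunion, measureReal_union hdisj measurableSet_Ici, real_Iic_neg_eq_real_Ici, two_mul]

theorem one_sub_exp_le_four_mul_compoundPoisson_Ici (ν : Measure ℝ) [IsFiniteMeasure ν]
    [ν.IsNegInvariant] {y : ℝ} (hy : 0 < y) :
    1 - Real.exp (-(2 * ν.real (Ici y))) ≤ 4 * (compoundPoisson ν).real (Ici y) := by
  have h := one_sub_exp_le_two_mul_compoundPoisson ν y
  rw [real_le_norm_eq_two_mul_real_Ici _ hy, real_le_norm_eq_two_mul_real_Ici _ hy] at h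
  linarith

theorem one_half_le_real_Ici_zero (μ : Measure ℝ) [IsProbabilityMeasure μ] [μ.IsNegInvariant] :
    1 / 2 ≤ μ.real (Ici 0) := by
  have hsymm := real_Iic_neg_eq_real_Ici μ 0
  have hcover := measureReal_union_le (μ := μ) (Iic (0 : ℝ)) (Ici 0)
  rw [Iic_union_Ici, probReal_univ] at hcover
  rw [neg_zero] at hsymm
  linarith

theorem real_Ici_le_two_mul_conv (μ ρ : Measure ℝ) [IsFiniteMeasure μ] [IsProbabilityMeasure ρ]
    [ρ.IsNegInvariant] (a : ℝ) : μ.real (Ici a) ≤ 2 * (μ ∗ ρ).real (Ici a) := by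
  have h : μ (Ici a) * ρ (Ici 0) ≤ (μ ∗ ρ) (Ici a) := by
    rw [conv_apply μ ρ measurableSet_Ici, mul_comm, ← setLIntegral_const]
    refine (setLIntegral_mono' measurableSet_Ici fun x hx => measure_mono fun w hw => ?_).trans
      (setLIntegral_le_lintegral (Ici a) _)
    simp only [mem_preimage, mem_Ici] at *
    linarith
  have h' := ENNReal.toReal_mono (measure_ne_top _ _) h
  rw [ENNReal.toReal_mul] at h'
  simp only [← measureReal_def] at h'
  nlinarith [one_half_le_real_Ici_zero ρ, measureReal_nonneg (μ := μ) (s := Ici a)]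

end Real

end Symmetric

/-! ### Exponential moments of compound Poisson laws -/

section ExponentialMoments

theorem lintegral_exp_compoundPoisson {ν : Measure ℝ} [IsFiniteMeasure ν] {s : ℝ}
    (hs : Integrable (fun x => Real.exp (s * x)) ν) :
    ∫⁻ x, ENNReal.ofReal (Real.exp (s * x)) ∂(compoundPoisson ν) =
      ENNReal.ofReal (Real.exp (∫ x, (Real.exp (s * x) - 1) ∂ν)) := by
  have hlint : ∫⁻ x, ENNReal.ofReal (Real.exp (s * x)) ∂ν =
      ENNReal.ofReal (∫ x, Real.exp (s * x) ∂ν) :=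
    (ofReal_integral_eq_lintegral_ofReal hs (ae_of_all _ fun x => (Real.exp_pos _).le)).symm
  rw [lintegral_compoundPoisson_of_map_add (by fun_prop) (by simp)
    (fun x y => by rw [mul_add, Real.exp_add, ENNReal.ofReal_mul (Real.exp_pos _).le])
    (hlint ▸ ENNReal.ofReal_ne_top), hlint,
    ENNReal.toReal_ofReal (integral_nonneg fun x => (Real.exp_pos _).le),
    integral_sub hs (integrable_const 1)]
  simp

theorem integrable_exp_compoundPoisson {ν : Measure ℝ} [IsFiniteMeasure ν] {s : ℝ}
    (hs : Integrable (fun x => Real.exp (s * x)) ν) :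
    Integrable (fun x => Real.exp (s * x)) (compoundPoisson ν) := by
  refine ⟨by fun_prop, ?_⟩
  rw [hasFiniteIntegral_iff_ofReal (ae_of_all _ fun x => (Real.exp_pos _).le),
    lintegral_exp_compoundPoisson hs]
  exact ENNReal.ofReal_lt_top

theorem mgf_compoundPoisson {ν : Measure ℝ} [IsFiniteMeasure ν] {s : ℝ}
    (hs : Integrable (fun x => Real.exp (s * x)) ν) :
    ProbabilityTheory.mgf id (compoundPoisson ν) s =
      Real.exp (∫ x, (Real.exp (s * x) - 1) ∂ν) := by
  simp only [ProbabilityTheory.mgf, id_eq]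
  rw [integral_eq_lintegral_of_nonneg_ae (ae_of_all _ fun x => (Real.exp_pos _).le) (by fun_prop),
    lintegral_exp_compoundPoisson hs, ENNReal.toReal_ofReal (Real.exp_pos _).le]

theorem compoundPoisson_Ici_le_exp {ν : Measure ℝ} [IsFiniteMeasure ν] {s : ℝ} (hs : 0 ≤ s)
    (hint : Integrable (fun x => Real.exp (s * x)) ν) (z : ℝ) :
    (compoundPoisson ν).real (Ici z) ≤
      Real.exp (-(s * z) + ∫ x, (Real.exp (s * x) - 1) ∂ν) := by
  have h := ProbabilityTheory.measure_ge_le_exp_mul_mgf (X := id) z hs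
    (integrable_exp_compoundPoisson hint)
  rwa [mgf_compoundPoisson hint, ← Real.exp_add, neg_mul] at h

theorem sq_integral_le_integral_sq_mul {Ω : Type*} [MeasurableSpace Ω] {μ : Measure Ω}
    [IsFiniteMeasure μ] {f : Ω → ℝ} (hf : MemLp f 2 μ) :
    (∫ x, f x ∂μ) ^ 2 ≤ (∫ x, f x ^ 2 ∂μ) * μ.real univ := by
  have hholder := integral_mul_norm_le_Lp_mul_Lq (μ := μ) (f := f) (g := fun _ => (1 : ℝ))
    Real.HolderConjugate.two_two (by simpa using hf) (memLp_const 1)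
  simp only [norm_one, mul_one, Real.rpow_two, one_pow, ← Real.sqrt_eq_rpow, Real.norm_eq_abs,
    sq_abs, integral_const, smul_eq_mul] at hholder
  have h := (abs_integral_le_integral_abs (f := f) (μ := μ)).trans hholder
  rw [← Real.sqrt_mul (integral_nonneg fun x => sq_nonneg _)] at h
  rw [← sq_abs]
  exact (Real.le_sqrt (abs_nonneg _)
    (mul_nonneg (integral_nonneg fun x => sq_nonneg _) measureReal_nonneg)).1 h

theorem paley_zygmund {Ω : Type*} [MeasurableSpace Ω] {μ : Measure Ω} [IsProbabilityMeasure μ]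
    {f : Ω → ℝ} (hf : MemLp f 2 μ) (hpos : 0 ≤ᵐ[μ] f) {θ : ℝ} (hθ₀ : 0 ≤ θ) (hθ₁ : θ ≤ 1) :
    (1 - θ) ^ 2 * (∫ x, f x ∂μ) ^ 2 ≤ (∫ x, f x ^ 2 ∂μ) * μ.real {x | θ * ∫ z, f z ∂μ ≤ f x} := by
  set m := ∫ x, f x ∂μ
  set A := {x | θ * m ≤ f x}
  have hm : 0 ≤ m := integral_nonneg_of_ae hpos
  have hint : Integrable f μ := hf.integrable one_le_two
  have hA : NullMeasurableSet A μ :=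
    nullMeasurableSet_le aemeasurable_const hf.aestronglyMeasurable.aemeasurable
  have hcompl : ∫ x in Aᶜ, f x ∂μ ≤ θ * m :=
    calc ∫ x in Aᶜ, f x ∂μ ≤ ∫ _ in Aᶜ, θ * m ∂μ :=
          setIntegral_mono_on_ae₀ hint.integrableOn (integrable_const _) hA.compl
            (ae_of_all _ fun x hx => (not_le.1 (show ¬θ * m ≤ f x from hx)).le)
      _ ≤ θ * m := by
          rw [setIntegral_const, smul_eq_mul]
          exact mul_le_of_le_one_left (by positivity) measureReal_le_one
  have hsplit : ∫ x in A, f x ∂μ + ∫ x in Aᶜ, f x ∂μ = m := integral_add_compl₀ hA hint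
  have hA_int : (1 - θ) * m ≤ ∫ x in A, f x ∂μ := by linarith
  calc (1 - θ) ^ 2 * m ^ 2 = ((1 - θ) * m) ^ 2 := by ring
    _ ≤ (∫ x in A, f x ∂μ) ^ 2 := pow_le_pow_left₀ (mul_nonneg (by linarith) hm) hA_int 2
    _ ≤ (∫ x in A, f x ^ 2 ∂μ) * μ.real A := by
        simpa using sq_integral_le_integral_sq_mul (hf.restrict A)
    _ ≤ (∫ x, f x ^ 2 ∂μ) * μ.real A := by
        refine mul_le_mul_of_nonneg_right ?_ measureReal_nonneg
        exact setIntegral_le_integral hf.integrable_sq (ae_of_all _ fun x => sq_nonneg _)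

theorem le_compoundPoisson_Ici {ν : Measure ℝ} [IsFiniteMeasure ν] {s a : ℝ} (hs : 0 < s)
    (hint : Integrable (fun x => Real.exp (s * x)) ν)
    (hint2 : Integrable (fun x => Real.exp (2 * s * x)) ν)
    (ha : s * a ≤ ∫ x, (Real.exp (s * x) - 1) ∂ν) :
    (1 - Real.exp (s * a - ∫ x, (Real.exp (s * x) - 1) ∂ν)) ^ 2 *
        Real.exp (2 * ∫ x, (Real.exp (s * x) - 1) ∂ν - ∫ x, (Real.exp (2 * s * x) - 1) ∂ν) ≤
      (compoundPoisson ν).real (Ici a) := by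
  have hmgf := mgf_compoundPoisson hint
  have hmgf2 := mgf_compoundPoisson hint2
  simp only [ProbabilityTheory.mgf, id_eq] at hmgf hmgf2
  set ψ := ∫ x, (Real.exp (s * x) - 1) ∂ν
  set ψ₂ := ∫ x, (Real.exp (2 * s * x) - 1) ∂ν
  have hsq (x : ℝ) : Real.exp (s * x) ^ 2 = Real.exp (2 * s * x) := by
    rw [← Real.exp_nat_mul]
    congr 1
    push_cast
    ring
  have hmem : MemLp (fun x => Real.exp (s * x)) 2 (compoundPoisson ν) := by
    rw [memLp_two_iff_integrable_sq (by fun_prop)]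
    simpa only [hsq] using integrable_exp_compoundPoisson hint2
  have hset : {x : ℝ | Real.exp (s * a - ψ) * Real.exp ψ ≤ Real.exp (s * x)} = Ici a := by
    ext x
    rw [mem_ofPred_eq, ← Real.exp_add, sub_add_cancel, Real.exp_le_exp, mem_Ici,
      mul_le_mul_iff_right₀ hs]
  have h := paley_zygmund hmem (ae_of_all _ fun x => (Real.exp_pos _).le) (Real.exp_pos _).le
    (Real.exp_le_one_iff.2 (sub_nonpos.2 ha))
  simp only [hsq, hmgf, hmgf2, hset] at h
  calc _ = (1 - Real.exp (s * a - ψ)) ^ 2 * Real.exp ψ ^ 2 / Real.exp ψ₂ := by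
        rw [Real.exp_sub (2 * ψ), ← Real.exp_nat_mul, Nat.cast_ofNat, mul_div_assoc]
    _ ≤ (compoundPoisson ν).real (Ici a) := (div_le_iff₀' (Real.exp_pos _)).2 h

end ExponentialMoments

section SymmetricCompoundPoisson

/-- The cumulant generating function at `s` of the infinitely divisible law whose Lévy measure is
the restriction of the symmetric measure `ν` to `[-R, R]`. Symmetry turns the integrand
`exp (s * x) - 1` into `cosh (s * x) - 1`, which is nonnegative and of order `x ^ 2` at `0`. -/
noncomputable def truncatedCGF (ν : Measure ℝ) (R s : ℝ) : ℝ :=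
  ∫ x in Icc (-R) R, (Real.cosh (s * x) - 1) ∂ν

theorem isNegInvariant_restrict_Icc_neg (ν : Measure ℝ) [ν.IsNegInvariant] (R : ℝ) :
    (ν.restrict (Icc (-R) R)).IsNegInvariant :=
  isNegInvariant_restrict ν (by simp)

theorem integrableOn_exp_mul_of_bddAbove {ν : Measure ℝ} [IsFiniteMeasure ν] {R s : ℝ}
    {S : Set ℝ} (hs : 0 ≤ s) (hS : MeasurableSet S) (hR : ∀ x ∈ S, x ≤ R) :
    IntegrableOn (fun x => Real.exp (s * x)) S ν := by
  refine Integrable.of_bound (by fun_prop) (Real.exp (s * R)) ?_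
  filter_upwards [ae_restrict_mem hS] with x hx
  rw [Real.norm_eq_abs, Real.abs_exp]
  gcongr
  exact hR x hx

theorem setIntegral_exp_mul_sub_one {ν : Measure ℝ} [IsFiniteMeasure ν] [ν.IsNegInvariant]
    {s : ℝ} (hs : 0 ≤ s) (R : ℝ) :
    ∫ x in Icc (-R) R, (Real.exp (s * x) - 1) ∂ν = truncatedCGF ν R s := by
  have := isNegInvariant_restrict_Icc_neg ν R
  have hint : IntegrableOn (fun x => Real.exp (s * x) - 1) (Icc (-R) R) ν :=
    (integrableOn_exp_mul_of_bddAbove hs measurableSet_Icc fun x hx => hx.2).sub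
      (integrable_const 1)
  rw [integral_eq_integral_half_add_neg hint, truncatedCGF]
  congr! 2
  rw [Real.cosh_eq, mul_neg]
  ring

/-- Conditioning on the absence of jumps larger than `R`, then Chernoff's bound. -/
theorem compoundPoisson_Ici_le_add_exp (ν : Measure ℝ) [IsFiniteMeasure ν] [ν.IsNegInvariant]
    (R z : ℝ) {s : ℝ} (hs : 0 ≤ s) :
    (compoundPoisson ν).real (Ici z) ≤
      ν.real (Ioi R) + Real.exp (-(s * z) + truncatedCGF ν R s) := by
  have hsub : Icc (-R) R ⊆ Iic R := Icc_subset_Iic_self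
  have hexp : IntegrableOn (fun x => Real.exp (s * x)) (Iic R) ν :=
    integrableOn_exp_mul_of_bddAbove hs measurableSet_Iic fun x hx => hx
  have hneg : ∫ x in Iic R, (Real.exp (s * x) - 1) ∂ν ≤ truncatedCGF ν R s := by
    have hleft : ∫ x in Iic R \ Icc (-R) R, (Real.exp (s * x) - 1) ∂ν ≤ 0 := by
      refine setIntegral_nonpos (measurableSet_Iic.diff measurableSet_Icc) fun x hx => ?_
      have hx : x ≤ 0 := by
        rcases hx with ⟨hxR, hx⟩
        by_contra! h
        exact hx ⟨by linarith [mem_Iic.1 hxR], hxR⟩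
      simpa using mul_nonpos_of_nonneg_of_nonpos hs hx
    have hint : IntegrableOn (fun x => Real.exp (s * x) - 1) (Iic R) ν :=
      hexp.sub (integrable_const 1)
    rw [← setIntegral_exp_mul_sub_one hs, ← integral_inter_add_sdiff measurableSet_Icc hint,
      inter_eq_self_of_subset_right hsub]
    linarith
  rw [compoundPoisson_eq_conv_restrict ν (measurableSet_Ioi (a := R)), compl_Ioi]
  refine (compoundPoisson_conv_real_le _ _ _).trans ?_
  rw [measureReal_restrict_apply_univ]
  gcongr
  refine (compoundPoisson_Ici_le_exp hs hexp z).trans ?_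
  gcongr

theorem le_two_mul_compoundPoisson_Ici (ν : Measure ℝ) [IsFiniteMeasure ν] [ν.IsNegInvariant]
    {R s a : ℝ} (hs : 0 < s) (ha : s * a ≤ truncatedCGF ν R s) :
    (1 - Real.exp (s * a - truncatedCGF ν R s)) ^ 2 *
        Real.exp (2 * truncatedCGF ν R s - truncatedCGF ν R (2 * s)) ≤
      2 * (compoundPoisson ν).real (Ici a) := by
  have : (ν.restrict (Icc (-R) R)ᶜ).IsNegInvariant := isNegInvariant_restrict ν (by simp)
  have hexp {r : ℝ} (hr : 0 ≤ r) : IntegrableOn (fun x => Real.exp (r * x)) (Icc (-R) R) ν :=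
    integrableOn_exp_mul_of_bddAbove hr measurableSet_Icc fun x hx => hx.2
  have hsmall := le_compoundPoisson_Ici hs (hexp hs.le) (hexp (by positivity : 0 ≤ 2 * s))
    (by rwa [setIntegral_exp_mul_sub_one hs.le])
  rw [setIntegral_exp_mul_sub_one hs.le,
    setIntegral_exp_mul_sub_one (by positivity : 0 ≤ 2 * s)] at hsmall
  rw [compoundPoisson_eq_conv_restrict ν (measurableSet_Icc (a := -R) (b := R))]
  exact hsmall.trans (real_Ici_le_two_mul_conv _ _ a)

theorem charFun_compoundPoisson_of_isNegInvariant (ν : Measure ℝ) [IsFiniteMeasure ν]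
    [ν.IsNegInvariant] (t : ℝ) :
    charFun (compoundPoisson ν) t = Complex.exp (∫ x, (Real.cos (t * x) - 1) ∂ν : ℝ) := by
  have hint : Integrable (fun x => Real.cos (t * x)) ν :=
    Integrable.of_bound (by fun_prop) 1 (ae_of_all _ fun x => Real.abs_cos_le_one _)
  have hcos : charFun ν t = (∫ x, Real.cos (t * x) ∂ν : ℝ) := by
    rw [charFun_apply, integral_eq_integral_half_add_neg (integrable_exp_inner_mul_I ν t),
      ← integral_complex_ofReal]
    congr! 2
    simp [Complex.cos]
  rw [charFun_compoundPoisson, hcos, integral_sub hint (integrable_const 1)]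
  simp

end SymmetricCompoundPoisson

/-! ### Weak limits -/

section WeakLimit

variable {E : Type*} [NormedAddCommGroup E] [InnerProductSpace ℝ E] [FiniteDimensional ℝ E]
  [MeasurableSpace E] [BorelSpace E] {μ : Measure E} [IsProbabilityMeasure μ] {κ : ℕ → Measure E}
  [∀ n, IsProbabilityMeasure (κ n)]

theorem le_measureReal_of_tendsto_charFun
    (h : ∀ t, Tendsto (fun n => charFun (κ n) t) atTop (𝓝 (charFun μ t))) {F : Set E}
    (hF : IsClosed F) {b : ℕ → ℝ} {l : ℝ} (hb : Tendsto b atTop (𝓝 l))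
    (hle : ∀ᶠ n in atTop, b n ≤ (κ n).real F) : l ≤ μ.real F := by
  have hlim : Tendsto (β := ProbabilityMeasure E) (fun n => ⟨κ n, inferInstance⟩) atTop
      (𝓝 (id (α := ProbabilityMeasure E) ⟨μ, inferInstance⟩)) :=
    ProbabilityMeasure.tendsto_of_tendsto_charFun h
  have hofReal : ENNReal.ofReal l ≤ μ F := by
    refine le_trans ?_ (ProbabilityMeasure.limsup_measure_closed_le_of_tendsto hlim hF)
    rw [← (ENNReal.tendsto_ofReal hb).limsup_eq]
    exact limsup_le_limsup (hle.mono fun n hn => ENNReal.ofReal_le_of_le_toReal hn)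
  exact (ENNReal.ofReal_le_iff_le_toReal (measure_ne_top _ _)).1 hofReal

theorem measureReal_le_of_tendsto_charFun
    (h : ∀ t, Tendsto (fun n => charFun (κ n) t) atTop (𝓝 (charFun μ t))) {G : Set E}
    (hG : IsOpen G) {b : ℝ} (hle : ∀ᶠ n in atTop, (κ n).real G ≤ b) : μ.real G ≤ b := by
  have hcompl : 1 - b ≤ μ.real Gᶜ :=
    le_measureReal_of_tendsto_charFun h hG.isClosed_compl tendsto_const_nhds <|
      hle.mono fun n hn => by
        rw [probReal_compl_eq_one_sub hG.measurableSet]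
        linarith
  rw [probReal_compl_eq_one_sub hG.measurableSet] at hcompl
  linarith

end WeakLimit

/-! ### The remainder of the hyperbolic cosine -/

section CoshRemainder

/-- The remainder `cosh u - 1 - u ^ 2 / 2` of the second order Taylor expansion of `cosh` at `0`:
the excess of the cumulant generating function of a symmetric jump over the Gaussian one. -/
noncomputable def coshRemainder (u : ℝ) : ℝ := Real.cosh u - 1 - u ^ 2 / 2

theorem hasSum_coshRemainder (u : ℝ) :
    HasSum (fun n : ℕ => u ^ (2 * (n + 2)) / (2 * (n + 2))!) (coshRemainder u) := by
  have h := (hasSum_nat_add_iff' 2).2 (Real.hasSum_cosh u)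
  simpa [Finset.sum_range_succ, sub_sub, coshRemainder] using h

theorem coshRemainder_nonneg (u : ℝ) : 0 ≤ coshRemainder u :=
  (hasSum_coshRemainder u).nonneg fun n => by
    rw [pow_mul]
    positivity

theorem coshRemainder_mul_le {r : ℝ} (hr : |r| ≤ 1) (u : ℝ) :
    coshRemainder (r * u) ≤ r ^ 4 * coshRemainder u := by
  refine hasSum_le (fun n => ?_) (hasSum_coshRemainder (r * u))
    ((hasSum_coshRemainder u).mul_left _)
  have hpow : (r ^ 2) ^ n ≤ 1 :=
    pow_le_one₀ (sq_nonneg r) ((sq_le_one_iff_abs_le_one r).2 hr)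
  have hterm : 0 ≤ r ^ 4 * (u ^ (2 * (n + 2)) / ((2 * (n + 2))! : ℝ)) := by
    rw [pow_mul u]
    positivity
  calc (r * u) ^ (2 * (n + 2)) / ((2 * (n + 2))! : ℝ)
      = (r ^ 2) ^ n * (r ^ 4 * (u ^ (2 * (n + 2)) / ((2 * (n + 2))! : ℝ))) := by ring
    _ ≤ r ^ 4 * (u ^ (2 * (n + 2)) / ((2 * (n + 2))! : ℝ)) :=
        mul_le_of_le_one_left hterm hpow

theorem coshRemainder_mul_le_of_abs_le {x R : ℝ} (hR : 0 < R) (hx : |x| ≤ R) (s : ℝ) :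
    coshRemainder (s * x) ≤ coshRemainder (s * R) / R ^ 4 * x ^ 4 := by
  have hr : |x / R| ≤ 1 := by rwa [abs_div, abs_of_pos hR, div_le_one hR]
  calc coshRemainder (s * x) = coshRemainder (x / R * (s * R)) := by field_simp
    _ ≤ (x / R) ^ 4 * coshRemainder (s * R) := coshRemainder_mul_le hr _
    _ = _ := by ring

theorem coshRemainder_le_half_exp {u : ℝ} (hu : 0 ≤ u) : coshRemainder u ≤ Real.exp u / 2 := by
  have hexp : Real.exp (-u) ≤ 1 := Real.exp_le_one_iff.2 (by linarith)
  rw [coshRemainder, Real.cosh_eq]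
  linarith [sq_nonneg u]

theorem coshRemainder_le_mul_sinh_sub (u : ℝ) :
    coshRemainder u ≤ u * (Real.sinh u - u) / 4 := by
  have hsinh := (hasSum_nat_add_iff' 1).2 (Real.hasSum_sinh u)
  simp only [Finset.range_one, Finset.sum_singleton, mul_zero, zero_add, pow_one,
    Nat.factorial_one, Nat.cast_one, div_one] at hsinh
  refine hasSum_le (fun n => ?_) (hasSum_coshRemainder u) ((hsinh.mul_left u).div_const 4)
  have hpow : 0 ≤ u ^ (2 * (n + 2)) := by
    rw [pow_mul]
    positivity
  calc u ^ (2 * (n + 2)) / ((2 * (n + 2))! : ℝ)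
      = u ^ (2 * (n + 2)) / ((2 * n + 4) * (2 * (n + 1) + 1)!) := by
        rw [show 2 * (n + 2) = 2 * (n + 1) + 1 + 1 by ring, Nat.factorial_succ]
        push_cast
        ring_nf
    _ ≤ u ^ (2 * (n + 2)) / (4 * (2 * (n + 1) + 1)!) := by
        gcongr
        linarith [(n.cast_nonneg : (0 : ℝ) ≤ n)]
    _ = u * (u ^ (2 * (n + 1) + 1) / (2 * (n + 1) + 1)!) / 4 := by field_simp; ring

theorem coshRemainder_le_mul_exp {u : ℝ} (hu : 0 ≤ u) :
    coshRemainder u ≤ u * Real.exp u / 8 := by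
  have hsinh : Real.sinh u - u ≤ Real.exp u / 2 := by
    rw [Real.sinh_eq]
    linarith [Real.exp_pos (-u)]
  calc coshRemainder u ≤ u * (Real.sinh u - u) / 4 := coshRemainder_le_mul_sinh_sub u
    _ ≤ u * (Real.exp u / 2) / 4 := by gcongr
    _ = u * Real.exp u / 8 := by ring

end CoshRemainder

/-! ### Symmetric infinitely divisible laws -/

section SymmetricLevyMeasure

/-- The part of the Lévy measure `ν` that is responsible for the jumps larger than `δ`. -/
noncomputable def largeJumps (ν : Measure ℝ) (δ : ℝ) : Measure ℝ := ν.restrict {x | δ < |x|}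

theorem measurableSet_lt_abs (δ : ℝ) : MeasurableSet {x : ℝ | δ < |x|} :=
  measurableSet_lt measurable_const measurable_abs

instance isNegInvariant_largeJumps (ν : Measure ℝ) [ν.IsNegInvariant] (δ : ℝ) :
    (largeJumps ν δ).IsNegInvariant :=
  isNegInvariant_restrict ν (by simp)

theorem tendsto_integral_largeJumps {E : Type*} [NormedAddCommGroup E] [NormedSpace ℝ E]
    {ν : Measure ℝ} {f : ℝ → E} (hf : Integrable f ν) (hf0 : f 0 = 0) :
    Tendsto (fun n : ℕ => ∫ x, f x ∂(largeJumps ν (1 / (n + 1)))) atTop (𝓝 (∫ x, f x ∂ν)) := by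
  have hunion : ⋃ n : ℕ, {x : ℝ | 1 / ((n : ℝ) + 1) < |x|} = {0}ᶜ := by
    ext x
    simp only [mem_iUnion, mem_ofPred_eq, mem_compl_singleton_iff, ← abs_pos]
    exact ⟨fun ⟨n, hn⟩ => lt_trans (by positivity) hn, exists_nat_one_div_lt⟩
  have hlim := tendsto_setIntegral_of_monotone (f := f) (μ := ν)
    (fun n : ℕ => measurableSet_lt_abs (1 / ((n : ℝ) + 1)))
    (fun m n hmn x (hx : _ < |x|) => (Nat.one_div_le_one_div hmn).trans_lt hx) hf.integrableOn
  rwa [hunion, setIntegral_eq_integral_of_forall_compl_eq_zero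
    (fun x hx => by rwa [not_not.1 hx])] at hlim

theorem tendsto_truncatedCGF_largeJumps {ν : Measure ℝ} {R s : ℝ}
    (hint : IntegrableOn (fun x => Real.cosh (s * x) - 1) (Icc (-R) R) ν) :
    Tendsto (fun n : ℕ => truncatedCGF (largeJumps ν (1 / (n + 1))) R s) atTop
      (𝓝 (truncatedCGF ν R s)) := by
  refine (tendsto_integral_largeJumps hint (by simp)).congr fun n => ?_
  rw [truncatedCGF, largeJumps, largeJumps, Measure.restrict_comm measurableSet_Icc]

theorem truncatedCGF_largeJumps_le {ν : Measure ℝ} {R s : ℝ}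
    (hint : IntegrableOn (fun x => Real.cosh (s * x) - 1) (Icc (-R) R) ν) (δ : ℝ) :
    truncatedCGF (largeJumps ν δ) R s ≤ truncatedCGF ν R s :=
  integral_mono_measure (Measure.restrict_mono le_rfl Measure.restrict_le_self)
    (ae_of_all _ fun _ => sub_nonneg.2 (Real.one_le_cosh _)) hint

section TruncatedCGF

variable {ν : Measure ℝ} {R : ℝ}

theorem measure_abs_ge_lt_top (hν : Integrable (fun x => min 1 (x ^ 2)) ν) {δ : ℝ} (hδ : 0 < δ) :
    ν {x | δ ≤ |x|} < ∞ := by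
  refine (measure_mono fun x hx => ?_).trans_lt
    (hν.measure_norm_ge_lt_top (ε := min 1 (δ ^ 2)) (by positivity))
  rw [mem_ofPred_eq, Real.norm_of_nonneg (by positivity), ← sq_abs x]
  have hx : δ ≤ |x| := hx
  gcongr

theorem isFiniteMeasure_largeJumps (hν : Integrable (fun x => min 1 (x ^ 2)) ν) {δ : ℝ}
    (hδ : 0 < δ) : IsFiniteMeasure (largeJumps ν δ) := by
  refine ⟨?_⟩
  rw [largeJumps, Measure.restrict_apply_univ]
  exact (measure_mono fun x (hx : δ < |x|) => hx.le).trans_lt (measure_abs_ge_lt_top hν hδ)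

theorem integrable_cos_sub_one (hν : Integrable (fun x => min 1 (x ^ 2)) ν) (t : ℝ) :
    Integrable (fun x => Real.cos (t * x) - 1) ν := by
  refine (hν.const_mul (2 + t ^ 2)).mono' (by fun_prop) (ae_of_all _ fun x => ?_)
  have hcos := Real.cos_le_one (t * x)
  rw [Real.norm_of_nonpos (by linarith), neg_sub]
  rcases min_choice 1 (x ^ 2) with hmin | hmin <;> rw [hmin]
  · nlinarith [Real.neg_one_le_cos (t * x)]
  · nlinarith [Real.one_sub_sq_div_two_le_cos (x := t * x), sq_nonneg x, sq_nonneg (t * x)]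

theorem integrableOn_pow_of_two_le (hν : Integrable (fun x => min 1 (x ^ 2)) ν) (R : ℝ) {p : ℕ}
    (hp : 2 ≤ p) : IntegrableOn (fun x => x ^ p) (Icc (-R) R) ν := by
  refine (hν.integrableOn.const_mul (max 1 (R ^ 2) * |R| ^ (p - 2))).mono' (by fun_prop) ?_
  filter_upwards [ae_restrict_mem measurableSet_Icc] with x hx
  have hxR : |x| ≤ |R| := (abs_le.2 hx).trans (le_abs_self R)
  have hsq : x ^ 2 ≤ max 1 (R ^ 2) * min 1 (x ^ 2) := by
    rcases min_choice 1 (x ^ 2) with hmin | hmin <;> rw [hmin]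
    · simpa using Or.inr (sq_le_sq.2 hxR)
    · exact le_mul_of_one_le_left (sq_nonneg x) (le_max_left _ _)
  calc ‖x ^ p‖ = |x| ^ (p - 2) * x ^ 2 := by
        rw [norm_pow, Real.norm_eq_abs, ← sq_abs x, ← pow_add, Nat.sub_add_cancel hp]
    _ ≤ |R| ^ (p - 2) * (max 1 (R ^ 2) * min 1 (x ^ 2)) := by gcongr
    _ = _ := by ring

theorem integrableOn_coshRemainder (hν : Integrable (fun x => min 1 (x ^ 2)) ν) (hR : 0 < R)
    (s : ℝ) : IntegrableOn (fun x => coshRemainder (s * x)) (Icc (-R) R) ν := by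
  refine ((integrableOn_pow_of_two_le hν R (by norm_num : 2 ≤ 4)).const_mul
    (coshRemainder (s * R) / R ^ 4)).mono' (by unfold coshRemainder; fun_prop) ?_
  filter_upwards [ae_restrict_mem measurableSet_Icc] with x hx
  rw [Real.norm_of_nonneg (coshRemainder_nonneg _)]
  exact coshRemainder_mul_le_of_abs_le hR (abs_le.2 hx) s

theorem integrableOn_cosh_sub_one (hν : Integrable (fun x => min 1 (x ^ 2)) ν) (hR : 0 < R)
    (s : ℝ) : IntegrableOn (fun x => Real.cosh (s * x) - 1) (Icc (-R) R) ν := by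
  refine (((integrableOn_pow_of_two_le hν R le_rfl).const_mul (s ^ 2 / 2)).add
    (integrableOn_coshRemainder hν hR s)).congr (ae_of_all _ fun x => ?_)
  simp only [coshRemainder, Pi.add_apply]
  ring

theorem truncatedCGF_eq (hν : Integrable (fun x => min 1 (x ^ 2)) ν) (hR : 0 < R) (s : ℝ) :
    truncatedCGF ν R s = s ^ 2 / 2 * ∫ x in Icc (-R) R, x ^ 2 ∂ν +
      ∫ x in Icc (-R) R, coshRemainder (s * x) ∂ν := by
  rw [truncatedCGF, ← integral_const_mul, ← integral_add
    ((integrableOn_pow_of_two_le hν R le_rfl).const_mul (s ^ 2 / 2))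
    (integrableOn_coshRemainder hν hR s)]
  congr! 2
  rw [coshRemainder]
  ring

theorem le_truncatedCGF (hν : Integrable (fun x => min 1 (x ^ 2)) ν) (hR : 0 < R) (s : ℝ) :
    s ^ 2 / 2 * ∫ x in Icc (-R) R, x ^ 2 ∂ν ≤ truncatedCGF ν R s := by
  rw [truncatedCGF_eq hν hR]
  exact le_add_of_nonneg_right (integral_nonneg fun x => coshRemainder_nonneg _)

theorem truncatedCGF_le (hν : Integrable (fun x => min 1 (x ^ 2)) ν) (hR : 0 < R) (s : ℝ) :
    truncatedCGF ν R s ≤ s ^ 2 / 2 * ∫ x in Icc (-R) R, x ^ 2 ∂ν +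
      coshRemainder (s * R) / R ^ 4 * ∫ x in Icc (-R) R, x ^ 4 ∂ν := by
  rw [truncatedCGF_eq hν hR, ← integral_const_mul (coshRemainder (s * R) / R ^ 4)]
  refine add_le_add_right ?_ _
  exact setIntegral_mono_on (integrableOn_coshRemainder hν hR s)
    ((integrableOn_pow_of_two_le hν R (by norm_num)).const_mul _) measurableSet_Icc
    fun x hx => coshRemainder_mul_le_of_abs_le hR (abs_le.2 hx) s

end TruncatedCGF

/-- `μ` is the law without Gaussian part whose Lévy measure is the symmetric measure `ν`. By
symmetry the compensated Lévy–Khintchine integrand may be replaced by its real part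
`cos (t * x) - 1`, which is integrable without a compensator. A mass of `ν` at `0` is irrelevant
and not excluded. -/
structure HasSymmetricLevyMeasure (μ ν : Measure ℝ) : Prop where
  isNegInvariant : ν.IsNegInvariant
  integrable_min_one_sq : Integrable (fun x => min 1 (x ^ 2)) ν
  charFun_eq : ∀ t, charFun μ t = Complex.exp (∫ x, (Real.cos (t * x) - 1) ∂ν : ℝ)

namespace HasSymmetricLevyMeasure

variable {μ ν : Measure ℝ} {R s : ℝ}

theorem tendsto_charFun (h : HasSymmetricLevyMeasure μ ν) (t : ℝ) :
    Tendsto (fun n : ℕ => charFun (compoundPoisson (largeJumps ν (1 / (n + 1)))) t) atTop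
      (𝓝 (charFun μ t)) := by
  have := h.isNegInvariant
  rw [h.charFun_eq]
  refine Tendsto.congr (fun n => ?_) (Tendsto.cexp (Complex.continuous_ofReal.tendsto _ |>.comp
    (tendsto_integral_largeJumps (integrable_cos_sub_one h.integrable_min_one_sq t) (by simp))))
  have : IsFiniteMeasure (largeJumps ν (1 / ((n : ℝ) + 1))) :=
    isFiniteMeasure_largeJumps h.integrable_min_one_sq Nat.one_div_pos_of_nat
  rw [charFun_compoundPoisson_of_isNegInvariant]
  rfl

variable [IsProbabilityMeasure μ]

theorem real_Ici_le_add_exp (h : HasSymmetricLevyMeasure μ ν) (hR : 0 < R) (hs : 0 ≤ s) (z : ℝ) :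
    μ.real (Ici z) ≤ ν.real (Ioi R) + Real.exp (-(s * z) + truncatedCGF ν R s) := by
  have := h.isNegInvariant
  have (n : ℕ) : IsFiniteMeasure (largeJumps ν (1 / ((n : ℝ) + 1))) :=
    isFiniteMeasure_largeJumps h.integrable_min_one_sq Nat.one_div_pos_of_nat
  have hlarge (n : ℕ) : (largeJumps ν (1 / ((n : ℝ) + 1))).real (Ioi R) ≤ ν.real (Ioi R) := by
    have hfin := measure_abs_ge_lt_top h.integrable_min_one_sq hR
    exact ENNReal.toReal_mono (ne_top_of_le_ne_top hfin.ne
      (measure_mono fun x hx => (le_of_lt hx).trans (le_abs_self x)))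
      (Measure.restrict_apply_le _ _)
  have hlt : ∀ w < z,
      μ.real (Ici z) ≤ ν.real (Ioi R) + Real.exp (-(s * w) + truncatedCGF ν R s) := by
    intro w hw
    refine (measureReal_mono (Ici_subset_Ioi.2 hw)).trans
      (measureReal_le_of_tendsto_charFun h.tendsto_charFun isOpen_Ioi <| .of_forall fun n => ?_)
    refine (measureReal_mono Ioi_subset_Ici_self).trans
      ((compoundPoisson_Ici_le_add_exp _ R w hs).trans ?_)
    gcongr
    · exact hlarge n
    · exact truncatedCGF_largeJumps_le (integrableOn_cosh_sub_one h.integrable_min_one_sq hR s) _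
  have hcont : Continuous fun w => ν.real (Ioi R) + Real.exp (-(s * w) + truncatedCGF ν R s) := by
    fun_prop
  exact ge_of_tendsto (hcont.continuousAt.tendsto.mono_left nhdsWithin_le_nhds)
    (eventually_mem_nhdsWithin.mono hlt : ∀ᶠ w in 𝓝[<] z, _)

theorem le_two_mul_real_Ici (h : HasSymmetricLevyMeasure μ ν) {a : ℝ} (hR : 0 < R)
    (hs : 0 < s) (ha : s * a < truncatedCGF ν R s) :
    (1 - Real.exp (s * a - truncatedCGF ν R s)) ^ 2 *
        Real.exp (2 * truncatedCGF ν R s - truncatedCGF ν R (2 * s)) ≤ 2 * μ.real (Ici a) := by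
  have := h.isNegInvariant
  have (n : ℕ) : IsFiniteMeasure (largeJumps ν (1 / ((n : ℝ) + 1))) :=
    isFiniteMeasure_largeJumps h.integrable_min_one_sq Nat.one_div_pos_of_nat
  have hlim (r : ℝ) := tendsto_truncatedCGF_largeJumps
    (integrableOn_cosh_sub_one h.integrable_min_one_sq hR r)
  have hbound := (((((hlim s).const_sub (s * a)).rexp.const_sub 1).pow 2).mul
    (((hlim s).const_mul 2).sub (hlim (2 * s))).rexp).div_const 2
  have hle := le_measureReal_of_tendsto_charFun h.tendsto_charFun isClosed_Ici hbound
    (((hlim s).eventually_const_lt ha).mono fun n hn =>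
      (div_le_iff₀' two_pos).2 (le_two_mul_compoundPoisson_Ici _ hs hn.le))
  exact (div_le_iff₀' two_pos).1 hle

theorem one_sub_exp_le_four_mul_real_Ici (h : HasSymmetricLevyMeasure μ ν) (hR : 0 < R) :
    1 - Real.exp (-(2 * ν.real (Ici R))) ≤ 4 * μ.real (Ici R) := by
  have := h.isNegInvariant
  have (n : ℕ) : IsFiniteMeasure (largeJumps ν (1 / ((n : ℝ) + 1))) :=
    isFiniteMeasure_largeJumps h.integrable_min_one_sq Nat.one_div_pos_of_nat
  have hsmall : ∀ᶠ n : ℕ in atTop, 1 / ((n : ℝ) + 1) < R :=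
    tendsto_one_div_add_atTop_nhds_zero_nat.eventually_lt_const hR
  have hle (n : ℕ) (hn : 1 / ((n : ℝ) + 1) < R) : (1 - Real.exp (-(2 * ν.real (Ici R)))) / 4 ≤
      (compoundPoisson (largeJumps ν (1 / ((n : ℝ) + 1)))).real (Ici R) := by
    have hlarge : (largeJumps ν (1 / ((n : ℝ) + 1))).real (Ici R) = ν.real (Ici R) := by
      have hsub : Ici R ⊆ {x | 1 / ((n : ℝ) + 1) < |x|} := fun x hx =>
        hn.trans_le (hx.trans (le_abs_self x))
      rw [largeJumps, measureReal_restrict_apply measurableSet_Ici,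
        inter_eq_self_of_subset_left hsub]
    rw [div_le_iff₀' four_pos, ← hlarge]
    exact one_sub_exp_le_four_mul_compoundPoisson_Ici _ hR
  exact (div_le_iff₀' four_pos).1 (le_measureReal_of_tendsto_charFun h.tendsto_charFun
    isClosed_Ici tendsto_const_nhds (hsmall.mono hle))

end HasSymmetricLevyMeasure

end SymmetricLevyMeasure

/-! ### The symmetric stable Lévy measure -/

section StableLevyMeasure

variable {α : ℝ}

theorem integrable_comp_abs {f : ℝ → ℝ} (hf : IntegrableOn f (Ioi 0)) :
    Integrable fun x => f |x| := by
  have hpos : IntegrableOn (fun x => f |x|) (Ioi 0) :=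
    hf.congr_fun (fun x hx => by simp only [abs_of_pos (mem_Ioi.1 hx)]) measurableSet_Ioi
  have hneg : IntegrableOn (fun x => f |x|) (Iio 0) := by simpa using hpos.comp_neg
  rw [← integrableOn_univ, ← Iic_union_Ioi (a := (0 : ℝ))]
  exact ((integrableOn_Iic_iff_integrableOn_Iio (by simp)).2 hneg).union hpos

instance isNegInvariant_symmetricStableLevyMeasure (α : ℝ) :
    (symmetricStableLevyMeasure α).IsNegInvariant := by
  rw [isNegInvariant_iff_map_neg]
  ext s hs
  rw [Measure.map_apply measurable_neg hs, symmetricStableLevyMeasure,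
    withDensity_apply _ (measurable_neg hs), withDensity_apply _ hs,
    ← lintegral_indicator (measurable_neg hs), ← lintegral_indicator hs,
    ← lintegral_neg_eq_self]
  refine lintegral_congr fun x => ?_
  by_cases hx : x ∈ s <;> simp [indicator, hx]

instance nullSingletonClass_symmetricStableLevyMeasure (α : ℝ) :
    NullSingletonClass (symmetricStableLevyMeasure α) :=
  ⟨fun x => withDensity_absolutelyContinuous _ _ (measure_singleton x)⟩

theorem integrable_comp_abs_symmetricStableLevyMeasure {f : ℝ → ℝ}
    (hf : IntegrableOn (fun x => x ^ (-α - 1) * f x) (Ioi 0)) :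
    Integrable (fun x => f |x|) (symmetricStableLevyMeasure α) := by
  rw [symmetricStableLevyMeasure,
    integrable_withDensity_iff_integrable_smul' (by fun_prop) (ae_of_all _ fun x => by simp)]
  refine (integrable_comp_abs hf).congr (ae_of_all _ fun x => ?_)
  simp only [smul_eq_mul]
  rw [ENNReal.toReal_ofReal (by positivity)]

theorem integral_comp_abs_symmetricStableLevyMeasure (f : ℝ → ℝ) :
    ∫ x, f |x| ∂(symmetricStableLevyMeasure α) =
      2 * ∫ x in Ioi 0, x ^ (-α - 1) * f x := by
  rw [symmetricStableLevyMeasure,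
    integral_withDensity_eq_integral_toReal_smul (by fun_prop) (ae_of_all _ fun x => by simp),
    ← integral_comp_abs]
  congr! 2
  rw [ENNReal.toReal_ofReal (by positivity), smul_eq_mul]

theorem symmetricStableLevyMeasure_real_Ioi (hα : 0 < α) {R : ℝ} (hR : 0 < R) :
    (symmetricStableLevyMeasure α).real (Ioi R) = 1 / (α * R ^ α) := by
  have hlint : symmetricStableLevyMeasure α (Ioi R) =
      ∫⁻ x in Ioi R, ENNReal.ofReal (x ^ (-α - 1)) := by
    rw [symmetricStableLevyMeasure, withDensity_apply _ measurableSet_Ioi]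
    exact setLIntegral_congr_fun measurableSet_Ioi fun x hx => by
      simp only [abs_of_pos (hR.trans hx)]
  have hnonneg : ∀ᵐ x ∂volume.restrict (Ioi R), 0 ≤ x ^ (-α - 1) :=
    (ae_restrict_mem measurableSet_Ioi).mono fun x hx => Real.rpow_nonneg (hR.trans hx).le _
  rw [measureReal_def, hlint, ← integral_eq_lintegral_of_nonneg_ae hnonneg (by fun_prop),
    integral_Ioi_rpow_of_lt (by linarith) hR, sub_add_cancel, neg_div_neg_eq,
    Real.rpow_neg hR.le]
  field_simp

theorem setIntegral_pow_symmetricStableLevyMeasure {p : ℕ} (hp : Even p) (hα : α < p) {R : ℝ}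
    (hR : 0 ≤ R) :
    ∫ x in Icc (-R) R, x ^ p ∂(symmetricStableLevyMeasure α) =
      2 * (R ^ (p - α) / (p - α)) := by
  calc ∫ x in Icc (-R) R, x ^ p ∂(symmetricStableLevyMeasure α)
      = ∫ x, (Iic R).indicator (fun x => x ^ p) |x| ∂(symmetricStableLevyMeasure α) := by
        rw [← integral_indicator measurableSet_Icc]
        congr! 2
        simp only [indicator_apply, mem_Icc, mem_Iic, abs_le, hp.pow_abs]
    _ = 2 * ∫ x in Ioi 0, (Iic R).indicator (fun x => x ^ (p - α - 1)) x := by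
        rw [integral_comp_abs_symmetricStableLevyMeasure]
        congr 1
        refine setIntegral_congr_fun measurableSet_Ioi fun x (hx : 0 < x) => ?_
        simp only [indicator_apply, mul_ite, mul_zero]
        rw [← Real.rpow_natCast, ← Real.rpow_add hx]
        ring_nf
    _ = 2 * (R ^ (p - α) / (p - α)) := by
        rw [setIntegral_indicator measurableSet_Iic, Ioi_inter_Iic,
          ← intervalIntegral.integral_of_le hR, integral_rpow (Or.inl (by linarith)),
          sub_add_cancel, Real.zero_rpow (by linarith), sub_zero]

theorem integrable_min_pow_symmetricStableLevyMeasure {p q : ℕ} (hp : p < α) (hq : α < q) :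
    Integrable (fun x => min (|x| ^ p) (|x| ^ q)) (symmetricStableLevyMeasure α) := by
  have hpow {r : ℕ} {x : ℝ} (hx : 0 < x) : x ^ (-α - 1) * x ^ r = x ^ (r - α - 1) := by
    rw [← Real.rpow_natCast, ← Real.rpow_add hx]
    ring_nf
  have hmin {r : ℕ} (hr : ∀ y : ℝ, min (y ^ p) (y ^ q) ≤ y ^ r) {S : Set ℝ}
      (hS : MeasurableSet S) (hpos : S ⊆ Ioi 0) (hint : IntegrableOn (fun x => x ^ (r - α - 1)) S) :
      IntegrableOn (fun x => x ^ (-α - 1) * min (x ^ p) (x ^ q)) S := by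
    refine Integrable.mono' hint (by fun_prop) ?_
    filter_upwards [ae_restrict_mem hS] with x hx
    have hx : 0 < x := hpos hx
    rw [Real.norm_of_nonneg (by positivity), ← hpow hx]
    gcongr
    exact hr x
  refine integrable_comp_abs_symmetricStableLevyMeasure (f := fun x => min (x ^ p) (x ^ q)) ?_
  rw [← Ioc_union_Ioi_eq_Ioi zero_le_one]
  refine .union (hmin (fun y => min_le_right _ _) measurableSet_Ioc (fun x hx => hx.1)
    (intervalIntegral.intervalIntegrable_rpow' (by linarith)).1) ?_
  exact hmin (fun y => min_le_left _ _) measurableSet_Ioi (Ioi_subset_Ioi zero_le_one)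
    (integrableOn_Ioi_rpow_of_lt (by linarith) one_pos)

theorem integrable_min_one_sq_symmetricStableLevyMeasure (hα : α ∈ Ioo (0 : ℝ) 2) :
    Integrable (fun x => min 1 (x ^ 2)) (symmetricStableLevyMeasure α) := by
  simpa using integrable_min_pow_symmetricStableLevyMeasure (p := 0) (q := 2)
    (by simpa using hα.1) (by simpa using hα.2)

theorem norm_exp_mul_I_sub_one_sub_le (u : ℝ) :
    ‖Complex.exp (u * Complex.I) - 1 - u * Complex.I‖ ≤ 3 * min |u| (u ^ 2) := by
  have hnorm : ‖(u : ℂ) * Complex.I‖ = |u| := by simp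
  rw [← sq_abs]
  rcases le_total |u| 1 with h | h
  · rw [min_eq_right (pow_le_of_le_one (abs_nonneg u) h two_ne_zero)]
    have hexp := Complex.norm_exp_sub_one_sub_id_le (hnorm.trans_le h)
    rw [hnorm] at hexp
    linarith [sq_nonneg |u|]
  · rw [min_eq_left (le_self_pow₀ h two_ne_zero)]
    calc ‖Complex.exp (u * Complex.I) - 1 - u * Complex.I‖
        ≤ ‖Complex.exp (u * Complex.I)‖ + ‖(1 : ℂ)‖ + ‖(u : ℂ) * Complex.I‖ :=
          (norm_sub_le _ _).trans (add_le_add_left (norm_sub_le _ _) _)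
      _ ≤ 3 * |u| := by
          rw [Complex.norm_exp_ofReal_mul_I, norm_one, hnorm]
          linarith

theorem integrable_exp_mul_I_sub_one_sub (hα : α ∈ Ioo (1 : ℝ) 2) (t : ℝ) :
    Integrable (fun x : ℝ => Complex.exp (t * x * Complex.I) - 1 - t * x * Complex.I)
      (symmetricStableLevyMeasure α) := by
  have hmin := integrable_min_pow_symmetricStableLevyMeasure (α := α) (p := 1) (q := 2)
    (by simpa using hα.1) (by simpa using hα.2)
  refine (hmin.const_mul (3 * max |t| (t ^ 2))).mono' (by fun_prop) (ae_of_all _ fun x => ?_)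
  have hbound := norm_exp_mul_I_sub_one_sub_le (t * x)
  push_cast at hbound
  refine hbound.trans ?_
  rw [abs_mul, mul_pow, pow_one, sq_abs, mul_assoc,
    mul_min_of_nonneg _ _ (le_max_of_le_left (abs_nonneg t))]
  gcongr
  exacts [le_max_left _ _, le_max_right _ _]

theorem IsSymmetricStable.hasSymmetricLevyMeasure {Ω : Type*} [MeasurableSpace Ω] {P : Measure Ω}
    {X : Ω → ℝ} (hα : α ∈ Ioo (1 : ℝ) 2) (hX : IsSymmetricStable P α X) :
    HasSymmetricLevyMeasure (P.map X) (symmetricStableLevyMeasure α) where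
  isNegInvariant := inferInstance
  integrable_min_one_sq :=
    integrable_min_one_sq_symmetricStableLevyMeasure ⟨one_pos.trans hα.1, hα.2⟩
  charFun_eq t := by
    rw [hX.charFun_eq, integral_eq_integral_half_add_neg (integrable_exp_mul_I_sub_one_sub hα t),
      ← integral_complex_ofReal]
    congr! 3
    push_cast
    rw [Complex.cos]
    ring_nf

theorem le_truncatedCGF_symmetricStableLevyMeasure (hα : α ∈ Ioo (0 : ℝ) 2) {R : ℝ}
    (hR : 0 < R) (s : ℝ) :
    (s * R) ^ 2 / ((2 - α) * R ^ α) ≤ truncatedCGF (symmetricStableLevyMeasure α) R s := by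
  refine le_of_eq_of_le ?_
    (le_truncatedCGF (integrable_min_one_sq_symmetricStableLevyMeasure hα) hR s)
  rw [setIntegral_pow_symmetricStableLevyMeasure even_two (by simpa using hα.2) hR.le, Nat.cast_two,
    Real.rpow_sub hR, Real.rpow_two]
  field_simp

theorem truncatedCGF_symmetricStableLevyMeasure_le (hα : α ∈ Ioo (0 : ℝ) 2) {R : ℝ}
    (hR : 0 < R) (s : ℝ) :
    truncatedCGF (symmetricStableLevyMeasure α) R s ≤
      (s * R) ^ 2 / ((2 - α) * R ^ α) + coshRemainder (s * R) / R ^ α := by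
  refine (truncatedCGF_le (integrable_min_one_sq_symmetricStableLevyMeasure hα) hR s).trans ?_
  rw [setIntegral_pow_symmetricStableLevyMeasure even_two (by simpa using hα.2) hR.le,
    setIntegral_pow_symmetricStableLevyMeasure (by decide) (by push_cast; linarith [hα.2]) hR.le,
    Nat.cast_two, Nat.cast_ofNat, Real.rpow_sub hR, Real.rpow_sub hR, Real.rpow_two,
    Real.rpow_ofNat]
  refine add_le_add (le_of_eq (by field_simp)) ?_
  have hrem := coshRemainder_nonneg (s * R)
  have hfactor : 2 / (4 - α) ≤ 1 := (div_le_one (by linarith [hα.2])).2 (by linarith [hα.2])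
  calc coshRemainder (s * R) / R ^ 4 * (2 * (R ^ 4 / R ^ α / (4 - α)))
      = coshRemainder (s * R) / R ^ α * (2 / (4 - α)) := by field_simp
    _ ≤ coshRemainder (s * R) / R ^ α := mul_le_of_le_one_right (by positivity) hfactor

end StableLevyMeasure

/-! ### Tail bounds for symmetric stable laws -/

section TailBounds

theorem exp_one_half_le : Real.exp (1 / 2) ≤ 7 / 3 := by
  have hsq : Real.exp (1 / 2) ^ 2 = Real.exp 1 := by
    rw [← Real.exp_nat_mul]
    norm_num
  exact abs_le_of_sq_le_sq' (by rw [hsq]; linarith [Real.exp_one_lt_d9]) (by norm_num) |>.2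

theorem coshRemainder_two_le : coshRemainder 2 ≤ 4 / 5 := by
  have hsq : Real.exp 2 = Real.exp 1 ^ 2 := by
    rw [← Real.exp_nat_mul]
    norm_num
  have hlower : 7.38 ≤ Real.exp 2 := by
    rw [hsq]
    nlinarith [Real.exp_one_gt_d9]
  have hupper : Real.exp 2 ≤ 7.39 := by
    rw [hsq]
    nlinarith [Real.exp_one_gt_d9, Real.exp_one_lt_d9]
  have hneg : Real.exp (-2) ≤ 0.136 := by
    rw [Real.exp_neg]
    exact inv_le_of_inv_le₀ (by norm_num) (by linarith)
  rw [coshRemainder, Real.cosh_eq]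
  linarith

theorem log_le_div_exp_one {a : ℝ} (ha : 0 < a) : Real.log a ≤ a / Real.exp 1 := by
  have h := Real.log_le_sub_one_of_pos (div_pos ha (Real.exp_pos 1))
  rw [Real.log_div ha.ne' (Real.exp_pos 1).ne', Real.log_exp] at h
  linarith

theorem two_div_rpow_self_le {ε : ℝ} (hε : 0 < ε) : (2 / ε) ^ ε ≤ 21 / 10 := by
  have hlog : Real.log (2 / ε) * ε ≤ 92 / 125 := by
    calc Real.log (2 / ε) * ε ≤ 2 / ε / Real.exp 1 * ε := by
          gcongr
          exact log_le_div_exp_one (by positivity)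
      _ = 2 / Real.exp 1 := by field_simp
      _ ≤ 92 / 125 := by
          rw [div_le_div_iff₀ (Real.exp_pos 1) (by norm_num)]
          linarith [Real.exp_one_gt_d9]
  have hsplit : Real.exp (92 / 125) * Real.exp (33 / 125) = Real.exp 1 := by
    rw [← Real.exp_add]
    norm_num
  have hquad := Real.quadratic_le_exp_of_nonneg (x := 33 / 125) (by norm_num)
  rw [Real.rpow_def_of_pos (by positivity)]
  refine (Real.exp_le_exp.2 hlog).trans ?_
  nlinarith [Real.exp_pos (92 / 125), Real.exp_one_lt_d9]

variable {α y : ℝ}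

theorem sq_le_mul_rpow (hα : α < 2) (hy : 0 < y) (hy' : y ≤ 2 / (2 - α)) :
    y ^ 2 ≤ 21 / 10 * y ^ α := by
  have hε : 0 < 2 - α := by linarith
  calc y ^ 2 = y ^ (2 - α) * y ^ α := by
        rw [← Real.rpow_add hy, sub_add_cancel, Real.rpow_two]
    _ ≤ 21 / 10 * y ^ α := by
        gcongr
        exact (Real.rpow_le_rpow hy.le hy' hε.le).trans (two_div_rpow_self_le hε)

theorem log_le_mul_of_le {a b c : ℝ} (ha : 0 < a) (hab : a ≤ b) (hone : 1 ≤ c * a)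
    (hlog : Real.log a ≤ c * a) : Real.log b ≤ c * b := by
  calc Real.log b = Real.log a + Real.log (b / a) := by
        rw [Real.log_div (ha.trans_le hab).ne' ha.ne']
        ring
    _ ≤ c * a + (b / a - 1) * (c * a) := by
        have hdiv := Real.log_le_sub_one_of_pos (div_pos (ha.trans_le hab) ha)
        have hba : 0 ≤ b / a - 1 := sub_nonneg.2 ((one_le_div ha).2 hab)
        nlinarith
    _ = c * b := by
        field_simp
        ring

theorem log_le_mul_rpow (hα : α ∈ Ico (1 : ℝ) 2) (hy : 2 / (2 - α) ≤ y) :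
    Real.log (y ^ α) ≤ (2 - α) * y ^ α := by
  have hε : 0 < 2 - α := sub_pos.2 hα.2
  have hw : 0 < 2 / (2 - α) := by positivity
  have hα₀ : 0 ≤ α := zero_le_one.trans hα.1
  have hlower : 4 / (21 / 10 * (2 - α)) ≤ (2 - α) * (2 / (2 - α)) ^ α := by
    have hsq := sq_le_mul_rpow hα.2 hw le_rfl
    calc 4 / (21 / 10 * (2 - α)) = (2 - α) * ((2 / (2 - α)) ^ 2 / (21 / 10)) := by
          field_simp
          norm_num
      _ ≤ (2 - α) * (2 / (2 - α)) ^ α := by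
          gcongr
          linarith
  refine log_le_mul_of_le (by positivity) (Real.rpow_le_rpow hw.le hy hα₀)
    (le_trans ?_ hlower) (le_trans ?_ hlower)
  · rw [le_div_iff₀ (by positivity)]
    linarith [hα.1]
  · calc Real.log ((2 / (2 - α)) ^ α) = α * Real.log (2 / (2 - α)) := Real.log_rpow hw α
      _ ≤ 2 * (2 / (2 - α) / Real.exp 1) :=
          mul_le_mul hα.2.le (log_le_div_exp_one hw)
            (Real.log_nonneg ((le_div_iff₀ hε).2 (by linarith))) zero_le_two
      _ = 4 / (Real.exp 1 * (2 - α)) := by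
          field_simp
          norm_num
      _ ≤ 4 / (21 / 10 * (2 - α)) := by
          gcongr
          linarith [Real.exp_one_gt_d9]

theorem exp_neg_mul_sq_le_one_div_rpow (hα : α ≤ 2) (hy : 1 ≤ y)
    (hy' : 2 ≤ (2 - α) * y) :
    Real.exp (-((2 - α) * y ^ 2)) ≤ 1 / y ^ α := by
  rw [Real.exp_neg, ← one_div]
  gcongr
  calc y ^ α ≤ y ^ (2 : ℝ) := Real.rpow_le_rpow_of_exponent_le hy hα
    _ = y ^ 2 := Real.rpow_two y
    _ ≤ Real.exp y ^ 2 := by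
        gcongr
        linarith [Real.add_one_le_exp y]
    _ = Real.exp (2 * y) := by
        rw [← Real.exp_nat_mul, Nat.cast_two]
    _ ≤ Real.exp ((2 - α) * y ^ 2) := Real.exp_le_exp.2 (by nlinarith)

namespace HasSymmetricLevyMeasure

variable {μ : Measure ℝ} [IsProbabilityMeasure μ]

theorem real_Ici_two_mul_le_of_nonneg (h : HasSymmetricLevyMeasure μ (symmetricStableLevyMeasure α))
    (hα : α ∈ Ico (1 : ℝ) 2) (hy : 0 < y) {u : ℝ} (hu : 0 ≤ u) :
    μ.real (Ici (2 * y)) ≤ 1 / y ^ α +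
      Real.exp (-(2 * u) + (u ^ 2 / ((2 - α) * y ^ α) + coshRemainder u / y ^ α)) := by
  have hα₀ : 0 < α := one_pos.trans_le hα.1
  have hs : u / y * y = u := div_mul_cancel₀ u hy.ne'
  have hcgf := truncatedCGF_symmetricStableLevyMeasure_le ⟨hα₀, hα.2⟩ hy (u / y)
  refine (h.real_Ici_le_add_exp hy (div_nonneg hu hy.le) (2 * y)).trans ?_
  rw [symmetricStableLevyMeasure_real_Ioi hα₀ hy, mul_left_comm, hs]
  rw [hs] at hcgf
  gcongr
  exact le_mul_of_one_le_left (by positivity) hα.1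

theorem real_Ici_two_mul_le_of_log_le
    (h : HasSymmetricLevyMeasure μ (symmetricStableLevyMeasure α))
    (hα : α ∈ Ico (1 : ℝ) 2) (hy : 1 ≤ y) (hlog : Real.log (y ^ α) ≤ (2 - α) * y ^ α) :
    μ.real (Ici (2 * y)) ≤ 10 / 3 * (1 / y ^ α) := by
  have hy₀ : 0 < y := one_pos.trans_le hy
  have hε : 0 < 2 - α := sub_pos.2 hα.2
  have hz : 0 < y ^ α := by positivity
  have hu : 0 ≤ Real.log (y ^ α) :=
    Real.log_nonneg (Real.one_le_rpow hy (zero_le_one.trans hα.1))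
  have hbound := h.real_Ici_two_mul_le_of_nonneg hα hy₀ hu
  have hrem := coshRemainder_le_half_exp hu
  rw [Real.exp_log hz] at hrem
  set u := Real.log (y ^ α) with hu_def
  have hquad : u ^ 2 / ((2 - α) * y ^ α) ≤ u := by
    rw [div_le_iff₀ (by positivity), sq]
    gcongr
  have hrem : coshRemainder u / y ^ α ≤ 1 / 2 := by
    rw [div_le_iff₀ hz]
    linarith
  calc μ.real (Ici (2 * y)) ≤ 1 / y ^ α + Real.exp (1 / 2 + -u) :=
        hbound.trans (add_le_add_right (Real.exp_le_exp.2 (by linarith)) _)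
    _ = (1 + Real.exp (1 / 2)) * (1 / y ^ α) := by
        rw [Real.exp_add, Real.exp_neg, hu_def, Real.exp_log hz]
        ring
    _ ≤ 10 / 3 * (1 / y ^ α) := by
        gcongr
        linarith [exp_one_half_le]

theorem real_Ici_two_mul_le_of_le_log
    (h : HasSymmetricLevyMeasure μ (symmetricStableLevyMeasure α)) (hα : α ∈ Ico (1 : ℝ) 2)
    (hy : 0 < y) (hy' : y ≤ 2 / (2 - α)) (hlog : (2 - α) * y ^ 2 / 4 ≤ Real.log (y ^ α)) :
    μ.real (Ici (2 * y)) ≤ 1 / y ^ α + Real.exp (-((2 - α) * y ^ 2 / 4)) := by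
  have hε : 0 < 2 - α := sub_pos.2 hα.2
  have hz : 0 < y ^ α := by positivity
  have hu : 0 ≤ (2 - α) * y ^ 2 / 4 := by positivity
  have hle : (2 - α) * y ^ 2 / 4 ≤ 21 / 40 * ((2 - α) * y ^ α) := by
    nlinarith [sq_le_mul_rpow hα.2 hy hy']
  refine (h.real_Ici_two_mul_le_of_nonneg hα hy hu).trans ?_
  set u := (2 - α) * y ^ 2 / 4
  have hquad : u ^ 2 / ((2 - α) * y ^ α) ≤ 21 / 40 * u := by
    rw [div_le_iff₀ (by positivity)]
    nlinarith
  have hrem : coshRemainder u / y ^ α ≤ 1 / 8 * u := by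
    have hexp : Real.exp u ≤ y ^ α := (Real.le_log_iff_exp_le hz).1 hlog
    rw [div_le_iff₀ hz]
    nlinarith [coshRemainder_le_mul_exp hu]
  gcongr
  linarith

theorem real_Ici_two_mul_le (h : HasSymmetricLevyMeasure μ (symmetricStableLevyMeasure α))
    (hα : α ∈ Ico (1 : ℝ) 2) (hy : 0 < y) :
    μ.real (Ici (2 * y)) ≤ 10 / 3 * (1 / y ^ α) + Real.exp (-((2 - α) * y ^ 2 / 4)) := by
  have hε : 0 < 2 - α := sub_pos.2 hα.2
  have hexp := Real.exp_pos (-((2 - α) * y ^ 2 / 4))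
  have hz : 0 < 1 / y ^ α := by positivity
  rcases le_total y 1 with hy1 | hy1
  · have hone : 1 ≤ 1 / y ^ α :=
      (one_le_div (by positivity)).2 (Real.rpow_le_one hy.le hy1 (zero_le_one.trans hα.1))
    linarith [measureReal_le_one (μ := μ) (s := Ici (2 * y))]
  rcases le_total (2 / (2 - α)) y with hy2 | hy2
  · linarith [h.real_Ici_two_mul_le_of_log_le hα hy1 (log_le_mul_rpow hα hy2)]
  rcases le_total ((2 - α) * y ^ 2 / 4) (Real.log (y ^ α)) with hlog | hlog
  · linarith [h.real_Ici_two_mul_le_of_le_log hα hy hy2 hlog]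
  · have hlog' : Real.log (y ^ α) ≤ (2 - α) * y ^ α := by
      have := sq_le_mul_rpow hα.2 hy hy2
      have : 0 < (2 - α) * y ^ α := by positivity
      nlinarith
    linarith [h.real_Ici_two_mul_le_of_log_le hα hy1 hlog']

theorem half_mul_one_div_le_real_Ici
    (h : HasSymmetricLevyMeasure μ (symmetricStableLevyMeasure α)) (hα : 0 < α) (hy : 0 < y) :
    1 / 2 * (1 / (2 + α * y ^ α)) ≤ μ.real (Ici y) := by
  have hjump := h.one_sub_exp_le_four_mul_real_Ici hy
  rw [← measureReal_congr Ioi_ae_eq_Ici, symmetricStableLevyMeasure_real_Ioi hα hy] at hjump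
  set z := α * y ^ α
  have hz : 0 < z := by positivity
  have hexp : Real.exp (-(2 * (1 / z))) ≤ 1 - 2 * (1 / (2 + z)) := by
    calc Real.exp (-(2 * (1 / z))) = (Real.exp (2 * (1 / z)))⁻¹ := Real.exp_neg _
      _ ≤ (2 * (1 / z) + 1)⁻¹ := inv_anti₀ (by positivity) (Real.add_one_le_exp _)
      _ = 1 - 2 * (1 / (2 + z)) := by
          field_simp
          ring
  linarith

theorem quarter_mul_one_div_rpow_le_real_Ici
    (h : HasSymmetricLevyMeasure μ (symmetricStableLevyMeasure α)) (hα : α ∈ Icc (1 : ℝ) 2)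
    (hy : 2 ≤ y) : 1 / 4 * (1 / y ^ α) ≤ μ.real (Ici (√2 / 4 * y)) := by
  have hy₀ : 0 < y := two_pos.trans_le hy
  have hα₀ : 0 < α := one_pos.trans_le hα.1
  have hsqrt : √2 / 4 ≤ 1 / 2 := by
    linarith [Real.sqrt_le_sqrt (show (2 : ℝ) ≤ 2 ^ 2 by norm_num), Real.sqrt_sq zero_le_two]
  have hz : 2 ≤ y ^ α := hy.trans (Real.self_le_rpow_of_one_le (by linarith) hα.1)
  have hle : α * (√2 / 4 * y) ^ α ≤ y ^ α := by
    calc α * (√2 / 4 * y) ^ α ≤ 2 * ((1 / 2) ^ α * y ^ α) := by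
          rw [Real.mul_rpow (by positivity) hy₀.le]
          gcongr
          exact hα.2
      _ ≤ 2 * (1 / 2 * y ^ α) := by
          gcongr
          exact Real.rpow_le_self_of_le_one (by norm_num) (by norm_num) hα.1
      _ = y ^ α := by ring
  calc 1 / 4 * (1 / y ^ α) = 1 / 2 * (1 / (y ^ α + y ^ α)) := by
        field_simp
        norm_num
    _ ≤ 1 / 2 * (1 / (2 + α * (√2 / 4 * y) ^ α)) := by gcongr
    _ ≤ μ.real (Ici (√2 / 4 * y)) := h.half_mul_one_div_le_real_Ici hα₀ (by positivity)

theorem exp_neg_le_mul_real_Ici (h : HasSymmetricLevyMeasure μ (symmetricStableLevyMeasure α))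
    (hα : α ∈ Ioo (0 : ℝ) 2) {s a : ℝ} (hs : s ∈ Ioc (0 : ℝ) 1)
    (ha : s * a + 0.292 ≤ s ^ 2 / (2 - α)) :
    Real.exp (-(2 * (s ^ 2 / (2 - α)) + 4 / 5)) ≤ 32 * μ.real (Ici a) := by
  have hlower := le_truncatedCGF_symmetricStableLevyMeasure hα one_pos s
  have hupper := truncatedCGF_symmetricStableLevyMeasure_le hα one_pos (2 * s)
  have hbound := h.le_two_mul_real_Ici one_pos hs.1 (a := a)
  simp only [mul_one, Real.one_rpow, div_one, mul_pow, mul_div_assoc] at hlower hupper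
  set ψ := truncatedCGF (symmetricStableLevyMeasure α) 1
  have hrem : coshRemainder (2 * s) ≤ 4 / 5 := by
    rw [mul_comm]
    exact (coshRemainder_mul_le (abs_le.2 ⟨by linarith [hs.1], hs.2⟩) 2).trans
      ((mul_le_of_le_one_left (coshRemainder_nonneg 2) (pow_le_one₀ hs.1.le hs.2)).trans
        coshRemainder_two_le)
  have hfactor : 1 / 4 ≤ 1 - Real.exp (s * a - ψ s) := by
    have hexp : Real.exp (-0.292) ≤ 3 / 4 := by
      rw [Real.exp_neg]
      refine inv_le_of_inv_le₀ (by norm_num) ?_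
      linarith [Real.quadratic_le_exp_of_nonneg (x := 0.292) (by norm_num)]
    linarith [Real.exp_le_exp.2 (by linarith : s * a - ψ s ≤ -0.292)]
  calc Real.exp (-(2 * (s ^ 2 / (2 - α)) + 4 / 5))
      ≤ Real.exp (2 * ψ s - ψ (2 * s)) := Real.exp_le_exp.2 (by linarith)
    _ = 16 * ((1 / 4) ^ 2 * Real.exp (2 * ψ s - ψ (2 * s))) := by ring
    _ ≤ 16 * ((1 - Real.exp (s * a - ψ s)) ^ 2 * Real.exp (2 * ψ s - ψ (2 * s))) := by gcongr
    _ ≤ 16 * (2 * μ.real (Ici a)) :=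
        mul_le_mul_of_nonneg_left (hbound (by linarith)) (by norm_num)
    _ = 32 * μ.real (Ici a) := by ring

theorem exp_neg_mul_sq_le_real_Ici_of_le
    (h : HasSymmetricLevyMeasure μ (symmetricStableLevyMeasure α))
    (hα : α ∈ Ioo (0 : ℝ) 2) (hy : 0 < y) (hT : 4 ≤ (2 - α) * y ^ 2) (hy' : y ≤ 2 / (2 - α)) :
    9 / 100 * Real.exp (-((2 - α) * y ^ 2)) ≤ μ.real (Ici (√2 / 4 * y)) := by
  have hε : 0 < 2 - α := sub_pos.2 hα.2
  have hs : (2 - α) * y / 2 ∈ Ioc (0 : ℝ) 1 :=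
    ⟨by positivity, by linarith [(le_div_iff₀' hε).1 hy']⟩
  have hquad : ((2 - α) * y / 2) ^ 2 / (2 - α) = (2 - α) * y ^ 2 / 4 := by
    field_simp
    norm_num
  have hsqrt : √2 ≤ 1.415 := Real.sqrt_le_iff.2 (by norm_num)
  have hbound := h.exp_neg_le_mul_real_Ici hα hs (a := √2 / 4 * y) (by
    rw [hquad]
    nlinarith)
  rw [hquad] at hbound
  have hconst : 72 / 25 ≤ Real.exp (6 / 5) := by
    linarith [Real.quadratic_le_exp_of_nonneg (x := 6 / 5) (by norm_num)]
  set T := (2 - α) * y ^ 2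
  have hexp : 72 / 25 * Real.exp (-T) ≤ 32 * μ.real (Ici (√2 / 4 * y)) := by
    calc 72 / 25 * Real.exp (-T) ≤ Real.exp (6 / 5) * Real.exp (-T) := by gcongr
      _ = Real.exp (6 / 5 - T) := by rw [← Real.exp_add, sub_eq_add_neg]
      _ ≤ Real.exp (-(2 * (T / 4) + 4 / 5)) := Real.exp_le_exp.2 (by linarith)
      _ ≤ _ := hbound
  linarith

theorem exp_neg_mul_sq_le_real_Ici
    (h : HasSymmetricLevyMeasure μ (symmetricStableLevyMeasure α))
    (hα : α ∈ Ico (1 : ℝ) 2) (hy : 2 ≤ y) (hT : 4 ≤ (2 - α) * y ^ 2) :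
    9 / 100 * Real.exp (-((2 - α) * y ^ 2)) ≤ μ.real (Ici (√2 / 4 * y)) := by
  rcases le_total y (2 / (2 - α)) with hy' | hy'
  · exact h.exp_neg_mul_sq_le_real_Ici_of_le ⟨one_pos.trans_le hα.1, hα.2⟩ (by linarith) hT hy'
  · have hexp := exp_neg_mul_sq_le_one_div_rpow hα.2.le (one_le_two.trans hy)
      ((div_le_iff₀' (sub_pos.2 hα.2)).1 hy')
    linarith [h.quarter_mul_one_div_rpow_le_real_Ici (Ico_subset_Icc_self hα) hy,
      Real.exp_pos (-((2 - α) * y ^ 2))]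

theorem add_exp_neg_mul_sq_le_real_Ici
    (h : HasSymmetricLevyMeasure μ (symmetricStableLevyMeasure α))
    (hα : α ∈ Ico (1 : ℝ) 2) (hy : 2 / √(2 - α) ≤ y) :
    1 / 40 * (1 / y ^ α) + 81 / 1000 * Real.exp (-((2 - α) * y ^ 2)) ≤
      μ.real (Ici (√2 / 4 * y)) := by
  have hsqrt : 0 < √(2 - α) := Real.sqrt_pos.2 (sub_pos.2 hα.2)
  have hle : 2 ≤ y * √(2 - α) := (div_le_iff₀ hsqrt).1 hy
  have hy₀ : 0 < y := (div_pos two_pos hsqrt).trans_le hy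
  have hy₂ : 2 ≤ y :=
    hle.trans (mul_le_of_le_one_right hy₀.le (Real.sqrt_le_one.2 (by linarith [hα.1])))
  have hT : 4 ≤ (2 - α) * y ^ 2 := by
    calc (4 : ℝ) = 2 ^ 2 := by norm_num
      _ ≤ (y * √(2 - α)) ^ 2 := by gcongr
      _ = (2 - α) * y ^ 2 := by
          rw [mul_pow, Real.sq_sqrt (sub_pos.2 hα.2).le, mul_comm]
  linarith [h.exp_neg_mul_sq_le_real_Ici hα hy₂ hT,
    h.quarter_mul_one_div_rpow_le_real_Ici (Ico_subset_Icc_self hα) hy₂]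

end HasSymmetricLevyMeasure

theorem one_div_six_mul_exp_five_le : 1 / (6 * Real.exp 5) ≤ 1 / 40 := by
  gcongr
  linarith [Real.quadratic_le_exp_of_nonneg (x := 5) (by norm_num)]

theorem one_div_six_mul_exp_one_le : 1 / (6 * Real.exp 1) ≤ 81 / 1000 := by
  rw [div_le_iff₀ (by positivity)]
  linarith [Real.exp_one_gt_d9]

end TailBounds

theorem theorem19_general {Ω : Type*} [MeasurableSpace Ω] {P : Measure Ω} [IsProbabilityMeasure P]
    {α : ℝ} (hα : α ∈ Ico (1 : ℝ) 2) {X : Ω → ℝ} (hX : AEMeasurable X P)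
    (hLevy : HasSymmetricLevyMeasure (P.map X) (symmetricStableLevyMeasure α)) :
    (∀ y : ℝ, 0 < y → P.real {ω | 2 * y ≤ X ω} ≤
        10 / 3 * (1 / y ^ α) + Real.exp (2 / 45) * Real.exp (-(1 / 4) * (2 - α) * y ^ 2)) ∧
      (∀ y : ℝ, 2 / Real.sqrt (2 - α) ≤ y →
        1 / (6 * Real.exp 5) * (1 / y ^ α) + 1 / (6 * Real.exp 1) * Real.exp (-(2 - α) * y ^ 2) ≤
          P.real {ω | Real.sqrt 2 / 4 * y ≤ X ω}) ∧
      (∀ y : ℝ, 2 / (2 - α) ≤ y → P.real {ω | 2 * y ≤ X ω} ≤ 16 / 3 * (1 / y ^ α)) ∧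
      (∀ y : ℝ, 0 < y → 1 / 2 * (1 / (2 + α * y ^ α)) ≤ P.real {ω | y ≤ X ω}) := by
  have hε : 0 < 2 - α := sub_pos.2 hα.2
  have := Measure.isProbabilityMeasure_map hX
  have htail (z : ℝ) : P.real {ω | z ≤ X ω} = (P.map X).real (Ici z) :=
    (map_measureReal_apply_of_aemeasurable hX measurableSet_Ici).symm
  simp only [htail]
  refine ⟨fun y hy => ?_, fun y hy => ?_, fun y hy => ?_,
    fun y hy => hLevy.half_mul_one_div_le_real_Ici (one_pos.trans_le hα.1) hy⟩
  · refine (hLevy.real_Ici_two_mul_le hα hy).trans (add_le_add_right ?_ _)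
    rw [show -(1 / 4) * (2 - α) * y ^ 2 = -((2 - α) * y ^ 2 / 4) by ring]
    exact le_mul_of_one_le_left (Real.exp_pos _).le (Real.one_le_exp (by norm_num))
  · have hy₀ : 0 < y := (by positivity : 0 < 2 / √(2 - α)).trans_le hy
    refine le_trans ?_ (hLevy.add_exp_neg_mul_sq_le_real_Ici hα hy)
    rw [neg_mul]
    exact add_le_add
      (mul_le_mul_of_nonneg_right one_div_six_mul_exp_five_le (by positivity))
      (mul_le_mul_of_nonneg_right one_div_six_mul_exp_one_le (by positivity))
  · have hy₁ : 1 ≤ y := ((one_le_div hε).2 (by linarith [hα.1])).trans hy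
    refine (hLevy.real_Ici_two_mul_le_of_log_le hα hy₁ (log_le_mul_rpow hα hy)).trans ?_
    gcongr
    norm_num

theorem theorem19 {Ω : Type*} [MeasurableSpace Ω] (P : Measure Ω) [IsProbabilityMeasure P]
    (α : ℝ) (hα : α ∈ Set.Ioo (1 : ℝ) 2) (X : Ω → ℝ) (hX : IsSymmetricStable P α X) :
    (∀ y ∈ Set.Icc (2 / Real.sqrt (2 - α)) (2 / (2 - α)),
      P.real {ω | 2 * y ≤ X ω} ≤
          10 / 3 * (1 / y ^ α) + Real.exp (2 / 45) * Real.exp (-(1 / 4) * (2 - α) * y ^ 2) ∧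
      1 / (6 * Real.exp 5) * (1 / y ^ α)
          + 1 / (6 * Real.exp 1) * Real.exp (-(2 - α) * y ^ 2) ≤
        P.real {ω | Real.sqrt 2 / 4 * y ≤ X ω}) ∧
    (∀ y : ℝ, 2 / (2 - α) ≤ y →
      P.real {ω | 2 * y ≤ X ω} ≤ 16 / 3 * (1 / y ^ α) ∧
      1 / 2 * (1 / (2 + α * y ^ α)) ≤ P.real {ω | y ≤ X ω}) := by
  obtain ⟨hupper, hlower, hupper', hlower'⟩ := theorem19_general (Ioo_subset_Ico_self hα)
    hX.aemeasurable (hX.hasSymmetricLevyMeasure hα)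
  have hε : 0 < 2 - α := sub_pos.2 hα.2
  have hpos : 0 < 2 / √(2 - α) := by positivity
  have hpos' : 0 < 2 / (2 - α) := by positivity
  exact ⟨fun y hy => ⟨hupper y (hpos.trans_le hy.1), hlower y hy.1⟩,
    fun y hy => ⟨hupper' y hy, hlower' y (hpos'.trans_le hy)⟩⟩
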